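/- There is an absolute constant $c>0$ such that the following holds for all $n\ge 2$, $L>0$, $\Delta>0$, $\sigma>0$ and $\beta\in[0,1-\frac1n]$. For $C\subseteq[n]$, the sun-shaped graph $\mathcal S_{n,C}$ is the undirected graph on $[n]$ in which two distinct nodes are adjacent if and only if at least one of them lies in $C$. There are center sets $C^0,C^1,\dots\subseteq[n]$ and matrices $W^0,W^1,\dots\in\mathbb R^{n\times n}$ such that, for every $t$: the non-zero off-diagonal entries of $W^t=[w^t_{i,j}]$ are exactly those at the edges of $\mathcal S_{n,C^t}$; $W^t\mathbf 1=\mathbf 1$ and $\mathbf 1^\top W^t=\mathbf 1^\top$; and $\|W^t-\frac1n\mathbf 1\mathbf 1^\top\|_2\le\beta$. Moreover, for every integer $T$ with $T\ge\frac1{1-\beta}$ and $T\ge\frac{\sigma^2}{nL\Delta}$ there is a dimension $d\ge1$ such that for every $x^{(0)}\in\mathbb R^d$ there are - differentiable functions $f_1,\dots,f_n:\mathbb R^d\to\mathbb R$, each with $L$-Lipschitz gradient, whose average $f=\frac1n\sum_{i=1}^n f_i$ is bounded below and satisfies $f(x^{(0)})-\inf_x f(x)\le\Delta$, and - stochastic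 gradient oracles $O_i(x;\zeta_i)$, $i\in[n]$, with $\mathbb E[O_i(x;\zeta_i)]=\nabla f_i(x)$ and $\mathbb E\|O_i(x;\zeta_i)-\nabla f_i(x)\|^2\le\sigma^2$ for all $x\in\mathbb R^d$, for which the output $\hat x$ after $T$ rounds of every zero-respecting partial-averaging algorithm started at $x^{(0)}$ satisfies $$\mathbb E\,\|\nabla f(\hat x)\|^2\;\ge\; c\left(\Big(\frac{\Delta L\sigma^2}{nT}\Big)^{1/2}+\frac{\Delta L}{T(1-\beta)}\right).$$ Here a partial-averaging algorithm (possibly randomized) proceeds in rounds $t=0,1,\dots$. In round $t$ every node $i$ queries its own oracle once, with a fresh independent seed, at a point that depends on what the node has learnt so far, and then sends a fixed finite number of vectors $y_i$ and receives the corresponding partial averages $z_i=\sum_j w^t_{i,j}y_j$. The output may depend on what all nodes have learnt in the $T$ rounds. All points and messages are expressed as displacements from $x^{(0)}$. The algorithm is zero-respecting if a coordinate of a node's query point or message (as a displacement) is non-zero only if that coordinate is non-zero in some oracle answer or some partial average that this node has received before, and a coordinate of $\hat x-x^{(0)}$ is non-zero only if it is non-zero in some oracle answer or partial average received by some node. 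-/

import Mathlib

open MeasureTheory

/-- `ℝ^d` with the Euclidean norm. -/
abbrev Vec (d : ℕ) : Type := EuclideanSpace ℝ (Fin d)

/-! ### Loss functions -/

/-- The global objective `f = (1/n) ∑ i, f i`. -/
noncomputable def avgLoss {n d : ℕ} (f : Fin n → Vec d → ℝ) (x : Vec d) : ℝ :=
  (1 / (n : ℝ)) * ∑ i, f i x

/-- The function class: every local loss has an `L`-Lipschitz gradient, and the global
objective is bounded below with initial gap at most `Δ`. -/
structure LossClass {n d : ℕ} (L Δ : ℝ) (x₀ : Vec d) (f : Fin n → Vec d → ℝ) : Prop where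
  differentiable : ∀ i, Differentiable ℝ (f i)
  lipschitz : ∀ i x y, ‖gradient (f i) x - gradient (f i) y‖ ≤ L * ‖x - y‖
  bddBelow : BddBelow (Set.range (avgLoss f))
  gap : avgLoss f x₀ - ⨅ x, avgLoss f x ≤ Δ

/-! ### Stochastic gradient oracles -/

/-- A stochastic oracle on `ℝ^d`: the law of its random seed, and its answer to a query `x`
as a (jointly measurable) function of `x` and of the seed. -/
structure StochOracle (d : ℕ) where
  Seed : Type
  mSeed : MeasurableSpace Seed
  law : Measure Seed
  isProb : IsProbabilityMeasure law
  answer : Vec d → Seed → Vec d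
  measurable_answer : Measurable (fun q : Vec d × Seed => answer q.1 q.2)

attribute [instance] StochOracle.mSeed StochOracle.isProb

/-- The oracle class: unbiased for the gradient of `f`, with variance at most `σ²`. -/
structure OracleClass {d : ℕ} (σ : ℝ) (f : Vec d → ℝ) (O : StochOracle d) : Prop where
  integrable : ∀ x, Integrable (O.answer x) O.law
  unbiased : ∀ x, ∫ ζ, O.answer x ζ ∂O.law = gradient f x
  variance : ∀ x, ∫⁻ ζ, ‖O.answer x ζ - gradient f x‖ₑ ^ 2 ∂O.law ≤ ENNReal.ofReal (σ ^ 2)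

/-! ### Sun-shaped graphs and weight matrices -/

/-- The sun-shaped graph on `n` nodes with center set `C`: a node of `C` is adjacent to all the
other nodes, a node outside `C` is adjacent exactly to the nodes of `C`. -/
def sunGraph {n : ℕ} (C : Set (Fin n)) : SimpleGraph (Fin n) where
  Adj i j := i ≠ j ∧ (i ∈ C ∨ j ∈ C)
  symm := ⟨fun _ _ h => ⟨h.1.symm, h.2.symm⟩⟩
  loopless := ⟨fun _ h => h.1 rfl⟩

/-- Weight matrices of connectivity `β` over the graph `G`; the norm is the spectral norm. -/
structure WeightClass {n : ℕ} (β : ℝ) (G : SimpleGraph (Fin n))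
    (W : Matrix (Fin n) (Fin n) ℝ) : Prop where
  zero_of_not_adj : ∀ i j, i ≠ j → ¬ G.Adj j i → W i j = 0
  row_sum : ∀ i, ∑ j, W i j = 1
  col_sum : ∀ j, ∑ i, W i j = 1
  norm_le : ‖Matrix.toEuclideanCLM (n := Fin n) (𝕜 := ℝ)
    (W - Matrix.of (fun _ _ => 1 / (n : ℝ)))‖ ≤ β

/-! ### Algorithms

Time is divided into rounds `t = 0, 1, 2, …`. In round `t` each node `i` queries its own oracle
once, at a point of its choice, then sends `m` vectors `y`, and receives their partial averages
`z_i = ∑ j, W^t i j • y_j`. All points and messages are expressed as displacements from the common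
starting point `x₀` (as the rows of `W^t` sum to `1`, averaging `x₀ + u_j` gives `x₀` plus the
average of the `u_j`). -/

/-- What a node learns in one round: the oracle's answer, and the `m` partial averages. -/
abbrev RoundData (d m : ℕ) : Type := Vec d × (Fin m → Vec d)

/-- What a node has learnt in rounds `0, …, t - 1`. -/
abbrev LocalHist (d m t : ℕ) : Type := Fin t → RoundData d m

/-- A (randomized) decentralized algorithm for `n` nodes in `ℝ^d`. `Rand` is its internal
randomness, which the nodes may share, and `m` is the number of vectors that a node
communicates per round. `query t i` is the point where node `i` queries its oracle in round `t`
(minus the starting point), `message t i` are the vectors that it then sends, after having seen the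
oracle's answer, and `output T` is the output after `T` rounds (minus the starting point),
which may use what all the nodes have learnt. -/
structure DecAlgorithm (n d : ℕ) where
  Rand : Type
  mRand : MeasurableSpace Rand
  randLaw : Measure Rand
  isProb : IsProbabilityMeasure randLaw
  m : ℕ
  query : (t : ℕ) → Fin n → Rand → LocalHist d m t → Vec d
  message : (t : ℕ) → Fin n → Rand → LocalHist d m t → Vec d → Fin m → Vec d
  output : (T : ℕ) → Rand → (Fin n → LocalHist d m T) → Vec d
  measurable_query : ∀ t i, Measurable (fun q : Rand × LocalHist d m t => query t i q.1 q.2)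
  measurable_message : ∀ t i, Measurable
    (fun q : Rand × LocalHist d m t × Vec d => message t i q.1 q.2.1 q.2.2)
  measurable_output : ∀ T, Measurable
    (fun q : Rand × (Fin n → LocalHist d m T) => output T q.1 q.2)

attribute [instance] DecAlgorithm.mRand DecAlgorithm.isProb

/-- Coordinate `k` is non-zero in some vector of the local history `H`. -/
def LocalHist.Active {d m t : ℕ} (H : LocalHist d m t) (k : Fin d) : Prop :=
  ∃ s, (H s).1 k ≠ 0 ∨ ∃ l, (H s).2 l k ≠ 0

namespace DecAlgorithm

variable {n d : ℕ}

/-- The zero-respecting policy: a coordinate of a node's local vectors can become non-zero (the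
model can leave the starting point in that coordinate) only if it is non-zero in an
answer of the node's own oracle or in a vector received by the node. A coordinate of the output
has to come from some node in this way. -/
structure ZeroRespecting (A : DecAlgorithm n d) : Prop where
  query : ∀ t i r (H : LocalHist d A.m t) k, A.query t i r H k ≠ 0 → H.Active k
  message : ∀ t i r (H : LocalHist d A.m t) g l k,
    A.message t i r H g l k ≠ 0 → H.Active k ∨ g k ≠ 0
  output : ∀ T r (H : Fin n → LocalHist d A.m T) k,
    A.output T r H k ≠ 0 → ∃ i, LocalHist.Active (H i) k

variable (A : DecAlgorithm n d) (W : ℕ → Matrix (Fin n) (Fin n) ℝ) (x₀ : Vec d)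
  (O : Fin n → StochOracle d)

/-- The answer of node `i`'s oracle in round `t`, given the histories of the nodes. -/
def oracleAnswer (r : A.Rand) (ζ : (a : ℕ × Fin n) → (O a.2).Seed) (t : ℕ)
    (H : Fin n → LocalHist d A.m t) (i : Fin n) : Vec d :=
  (O i).answer (x₀ + A.query t i r (H i)) (ζ (t, i))

/-- The histories of all the nodes after `t` rounds, where `r` is the internal randomness of the
algorithm and `ζ (s, i)` is the seed of node `i`'s oracle in round `s`. -/
noncomputable def run (r : A.Rand) (ζ : (a : ℕ × Fin n) → (O a.2).Seed) :
    (t : ℕ) → Fin n → LocalHist d A.m t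
  | 0 => fun _ => Fin.elim0
  | t + 1 => fun i =>
      let H := run r ζ t
      let g := A.oracleAnswer x₀ O r ζ t H
      Fin.snoc (α := fun _ => RoundData d A.m) (H i)
        (g i, fun l => ∑ j, W t i j • A.message t j r (H j) (g j) l)

/-- The final model `x̂` after `T` rounds. -/
noncomputable def finalPoint (T : ℕ) (ω : A.Rand × ((a : ℕ × Fin n) → (O a.2).Seed)) : Vec d :=
  x₀ + A.output T ω.1 (A.run W x₀ O ω.1 ω.2 T)

/-- The joint law of the internal randomness and of all the oracle seeds: everything is
independent, and each seed of node `i` follows the law of its oracle. -/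
noncomputable def randomness :
    Measure (A.Rand × ((a : ℕ × Fin n) → (O a.2).Seed)) :=
  A.randLaw.prod (Measure.infinitePi (fun a : ℕ × Fin n => (O a.2).law))

/-- `E ‖∇ f (x̂)‖²` for the output `x̂` after `T` rounds, as an element of `[0, ∞]`. -/
noncomputable def expectedSqGrad (f : Fin n → Vec d → ℝ) (T : ℕ) : ENNReal :=
  ∫⁻ ω, ‖gradient (avgLoss f) (A.finalPoint W x₀ O T ω)‖ₑ ^ 2 ∂(A.randomness O)

end DecAlgorithm

/-!
The lower bound rests on one hard function, the *chain* `chain w` on `ℝ^N`. Its `k`-th link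
`wall (x k) - gate (x (k - 1)) * ramp (x k)` rewards a large coordinate `x k`, but only once the
coordinate `x (k - 1)` is positive. Hence a derivative in an inactive coordinate vanishes unless the
preceding coordinate is active (`scaledGrad_apply_eq_zero`), while the gradient stays bounded away
from zero until the last coordinate is active (`quarter_le_norm_chainGrad`). Its gradient is Lipschitz
(`norm_chainGrad_sub_le`) and its range costs `O(N)` (`neg_le_chain`), so that, scaled to smoothness
`L` and initial gap `Δ`, a model with inactive last coordinate has `‖∇f‖² ≥ c Δ L / N`
(`exists_scale`, `le_norm_scaledGrad`). It remains to see how long a chain can be kept unfinished for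
`T` rounds; `lt_of_active_run` reduces this to bounds on the coordinates known to each node.

*Noise* (`noise_lower_bound`). All the nodes hold the same chain, and their oracles hide the fresh
coordinates except with probability `p`, when they multiply them by `1 / p`. Only one fresh coordinate
has a non-zero derivative, so the variance is of order `Δ L / (N p)`, and `p` may be of order
`Δ L / (N σ²)`. By Markov's inequality, `N` of the `n T` answers are revealing with probability at
most `n T p / N`, which is at most `1 / 2` for `N` of order `(n T Δ L / σ²)^(1/2)`.

*Communication* (`network_lower_bound`). The even links are held by one group of nodes, the odd links
by a disjoint one. The `k = ⌈n (1 - β)⌉` centers of the sun-shaped graphs run cyclically through `τ`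
disjoint blocks of the remaining nodes. A center that has not been one before in the period has no
news, so news passes from one group to the other only at the end of a period, and `T` rounds gain at
most `T / τ + 1` coordinates, where `τ` is of order `1 / (1 - β)`. (If `τ = 1` the only block may meet
the groups, which is harmless, as then every round is a period of its own.) The graph Laplacian `Λ` has no
eigenvalues but `0`, `k` and `n`, so that `1 - Λ / n` has connectivity `1 - k / n ≤ β`
(`norm_sunWeight_le`).
-/

namespace SunChain

/-! ### Gate, ramp and wall -/

theorem hasDerivAt_max_zero_sq (a : ℝ) :
    HasDerivAt (fun x : ℝ => (max x 0) ^ 2) (2 * max a 0) a := by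
  rcases lt_trichotomy a 0 with h | h | h
  · rw [max_eq_right h.le, mul_zero]
    refine (hasDerivAt_const a (0 : ℝ)).congr_of_eventuallyEq ?_
    filter_upwards [Iio_mem_nhds h] with x hx
    simp [max_eq_right (le_of_lt (Set.mem_Iio.1 hx))]
  · subst h
    rw [hasDerivAt_iff_tendsto_slope]
    have hc : Filter.Tendsto (fun x : ℝ => max x 0) (nhdsWithin 0 {0}ᶜ) (nhds (2 * max 0 0)) := by
      have : Continuous (fun x : ℝ => max x 0) := by fun_prop
      simpa using (this.tendsto 0).mono_left nhdsWithin_le_nhds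
    refine hc.congr' ?_
    filter_upwards [self_mem_nhdsWithin] with x hx
    have hx0 : x ≠ 0 := hx
    rw [slope_def_field]
    rcases le_total x 0 with h | h
    · simp [h]
    · simp only [max_eq_left h, max_self]
      field_simp
      ring
  · rw [max_eq_left h.le]
    have := hasDerivAt_pow 2 a
    refine HasDerivAt.congr_of_eventuallyEq (by simpa using this) ?_
    filter_upwards [Ioi_mem_nhds h] with x hx
    simp [max_eq_left (le_of_lt (Set.mem_Ioi.1 hx))]

/-- The gate: vanishes on `(-∞, 0]`, increases to `1` on `[0, ∞)`. -/
noncomputable def gate (a : ℝ) : ℝ := 1 - 1 / (1 + (max a 0) ^ 2)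

/-- The derivative of `gate`. -/
noncomputable def gateDeriv (a : ℝ) : ℝ := 2 * max a 0 / (1 + (max a 0) ^ 2) ^ 2

/-- The ramp: an increasing function with values in `(0, π)`, steep on `[-1, 1]`. -/
noncomputable def ramp (b : ℝ) : ℝ := Real.pi / 2 + Real.arctan b

/-- The derivative of `ramp`. -/
noncomputable def rampDeriv (b : ℝ) : ℝ := 1 / (1 + b ^ 2)

/-- The wall: quadratic on `(-∞, 0]`, zero on `[0, ∞)`. -/
noncomputable def wall (b : ℝ) : ℝ := (max (-b) 0) ^ 2 / 2

/-- The derivative of `wall`. -/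
noncomputable def wallDeriv (b : ℝ) : ℝ := -max (-b) 0

theorem hasDerivAt_gate (a : ℝ) : HasDerivAt gate (gateDeriv a) a := by
  have h := ((hasDerivAt_max_zero_sq a).const_add 1).inv (by positivity)
  have h2 := h.const_sub 1
  unfold gate
  simp only [one_div]
  refine h2.congr_deriv ?_
  unfold gateDeriv
  ring

theorem hasDerivAt_ramp (b : ℝ) : HasDerivAt ramp (rampDeriv b) b :=
  (Real.hasDerivAt_arctan b).const_add _

theorem hasDerivAt_wall (b : ℝ) : HasDerivAt wall (wallDeriv b) b := by
  have h := ((hasDerivAt_max_zero_sq (-b)).comp b (hasDerivAt_neg b)).div_const 2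
  refine h.congr_deriv ?_
  unfold wallDeriv
  ring

theorem gate_nonneg (a : ℝ) : 0 ≤ gate a := by
  have : 1 / (1 + (max a 0) ^ 2) ≤ 1 := by
    rw [div_le_one (by positivity)]
    nlinarith [sq_nonneg (max a 0)]
  unfold gate
  linarith

theorem gate_le_one (a : ℝ) : gate a ≤ 1 := by
  have : 0 ≤ 1 / (1 + (max a 0) ^ 2) := by positivity
  unfold gate
  linarith

theorem half_le_gate {a : ℝ} (h : 1 ≤ a) : 1 / 2 ≤ gate a := by
  have : 1 / (1 + (max a 0) ^ 2) ≤ 1 / 2 := by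
    rw [max_eq_left (by linarith)]
    apply one_div_le_one_div_of_le (by norm_num)
    nlinarith
  unfold gate
  linarith

@[simp] theorem gate_zero : gate 0 = 0 := by simp [gate]

@[simp] theorem gateDeriv_zero : gateDeriv 0 = 0 := by simp [gateDeriv]

@[simp] theorem wallDeriv_zero : wallDeriv 0 = 0 := by simp [wallDeriv]

theorem gateDeriv_nonneg (a : ℝ) : 0 ≤ gateDeriv a := by
  have : 0 ≤ max a 0 := le_max_right _ _
  unfold gateDeriv
  positivity

theorem gateDeriv_le_one (a : ℝ) : gateDeriv a ≤ 1 := by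
  unfold gateDeriv
  rw [div_le_one (by positivity)]
  nlinarith [sq_nonneg (max a 0 - 1), sq_nonneg ((max a 0) ^ 2)]

theorem ramp_nonneg (b : ℝ) : 0 ≤ ramp b := by
  have := Real.neg_pi_div_two_lt_arctan b
  unfold ramp
  linarith

theorem ramp_le_four (b : ℝ) : ramp b ≤ 4 := by
  have := Real.arctan_lt_pi_div_two b
  have := Real.pi_lt_four
  unfold ramp
  linarith

theorem rampDeriv_nonneg (b : ℝ) : 0 ≤ rampDeriv b := by
  unfold rampDeriv
  positivity

theorem rampDeriv_le_one (b : ℝ) : rampDeriv b ≤ 1 := by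
  unfold rampDeriv
  rw [div_le_one (by positivity)]
  nlinarith [sq_nonneg b]

theorem half_le_rampDeriv {b : ℝ} (h₁ : -1 ≤ b) (h₂ : b ≤ 1) : 1 / 2 ≤ rampDeriv b := by
  unfold rampDeriv
  apply one_div_le_one_div_of_le (by positivity)
  nlinarith

theorem wall_nonneg (b : ℝ) : 0 ≤ wall b := by
  unfold wall
  positivity

theorem wallDeriv_nonpos (b : ℝ) : wallDeriv b ≤ 0 :=
  neg_nonpos.2 (le_max_right _ _)

theorem wallDeriv_le (b : ℝ) : wallDeriv b ≤ b := by
  have := le_max_left (-b) 0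
  unfold wallDeriv
  linarith

theorem abs_max_zero_sub_le (a b : ℝ) : |max a 0 - max b 0| ≤ |a - b| :=
  abs_max_sub_max_le_abs a b 0

theorem abs_wallDeriv_sub_le (a b : ℝ) : |wallDeriv a - wallDeriv b| ≤ |a - b| := by
  have := abs_max_zero_sub_le (-b) (-a)
  unfold wallDeriv
  calc _ = |max (-b) 0 - max (-a) 0| := by congr 1; ring
    _ ≤ |-b - -a| := this
    _ = |a - b| := by congr 1; ring

/-- A function with derivative in `[0, 1]` is nonexpansive. -/
theorem abs_sub_le_of_hasDerivAt {f f' : ℝ → ℝ} (hf : ∀ x, HasDerivAt f (f' x) x)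
    (h₀ : ∀ x, 0 ≤ f' x) (h₁ : ∀ x, f' x ≤ 1) (a b : ℝ) : |f a - f b| ≤ |a - b| := by
  have := convex_univ.norm_image_sub_le_of_norm_hasDerivWithin_le (C := 1)
    (fun x _ => (hf x).hasDerivWithinAt)
    (fun x _ => by rw [Real.norm_of_nonneg (h₀ x)]; exact h₁ x) (Set.mem_univ b) (Set.mem_univ a)
  simpa using this

theorem abs_gate_sub_le (a b : ℝ) : |gate a - gate b| ≤ |a - b| :=
  abs_sub_le_of_hasDerivAt hasDerivAt_gate gateDeriv_nonneg gateDeriv_le_one a b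

theorem abs_ramp_sub_le (a b : ℝ) : |ramp a - ramp b| ≤ |a - b| :=
  abs_sub_le_of_hasDerivAt hasDerivAt_ramp rampDeriv_nonneg rampDeriv_le_one a b

theorem abs_rampDeriv_sub_le (a b : ℝ) : |rampDeriv a - rampDeriv b| ≤ |a - b| := by
  have h : rampDeriv a - rampDeriv b = (a - b) * (-(a + b) / ((1 + a ^ 2) * (1 + b ^ 2))) := by
    unfold rampDeriv
    field_simp
    ring
  rw [h, abs_mul]
  refine mul_le_of_le_one_right (abs_nonneg _) ?_
  rw [abs_div, abs_of_pos (show 0 < (1 + a ^ 2) * (1 + b ^ 2) by positivity),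
    div_le_one (by positivity), abs_le]
  constructor <;> nlinarith [sq_nonneg (a - 1), sq_nonneg (b - 1), sq_nonneg (a + 1),
    sq_nonneg (b + 1), sq_nonneg (a * b)]

theorem abs_gateDeriv_sub_le (a b : ℝ) : |gateDeriv a - gateDeriv b| ≤ 2 * |a - b| := by
  refine le_trans ?_ (mul_le_mul_of_nonneg_left (abs_max_zero_sub_le a b) zero_le_two)
  unfold gateDeriv
  have hu : 0 ≤ max a 0 := le_max_right _ _
  have hv : 0 ≤ max b 0 := le_max_right _ _
  generalize max a 0 = u at *
  generalize max b 0 = v at *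
  have h : 2 * u / (1 + u ^ 2) ^ 2 - 2 * v / (1 + v ^ 2) ^ 2 =
      2 * (u - v) * ((1 - 2 * (u * v) - u * v * (u ^ 2 + u * v + v ^ 2)) /
        ((1 + u ^ 2) ^ 2 * (1 + v ^ 2) ^ 2)) := by
    field_simp
    ring
  rw [h, abs_mul, abs_mul, abs_two]
  refine mul_le_of_le_one_right (by positivity) ?_
  have hp : 0 < (1 + u ^ 2) ^ 2 * (1 + v ^ 2) ^ 2 := by positivity
  rw [abs_div, abs_of_pos hp, div_le_one hp]
  have huv : 0 ≤ u * v := mul_nonneg hu hv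
  have h1 : 1 + 2 * (u * v) + u * v * (u ^ 2 + u * v + v ^ 2) ≤
      (1 + u ^ 2) ^ 2 * (1 + v ^ 2) ^ 2 := by
    have e : (1 + u ^ 2) ^ 2 * (1 + v ^ 2) ^ 2 = 1 + 2 * u ^ 2 + 2 * v ^ 2 + u ^ 4 + v ^ 4
      + 4 * (u ^ 2 * v ^ 2) + 2 * (u ^ 2 * v ^ 4) + 2 * (u ^ 4 * v ^ 2) + u ^ 4 * v ^ 4 := by ring
    have p1 : 0 ≤ u ^ 2 * v ^ 4 := by positivity
    have p2 : 0 ≤ u ^ 4 * v ^ 2 := by positivity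
    have p3 : 0 ≤ u ^ 4 * v ^ 4 := by positivity
    have p4 : 0 ≤ u ^ 2 * v ^ 2 := by positivity
    rw [e]
    nlinarith [sq_nonneg (u - v), sq_nonneg (u ^ 2 - u * v), sq_nonneg (v ^ 2 - u * v),
      sq_nonneg u, sq_nonneg v, sq_nonneg (u ^ 2), sq_nonneg (v ^ 2)]
  have h2 : 0 ≤ u * v * (u ^ 2 + u * v + v ^ 2) := by positivity
  rw [abs_le]
  constructor <;> linarith

/-! ### The chain function -/

/-- The coordinates of `x` shifted by one, preceded by a `1` and followed by zeros. -/
noncomputable def padded {N : ℕ} (x : Vec N) : ℕ → ℝ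
  | 0 => 1
  | k + 1 => if h : k < N then x ⟨k, h⟩ else 0

/-- The derivative of `fun x => padded x k`. -/
noncomputable def paddedDeriv (N : ℕ) : ℕ → (Vec N →L[ℝ] ℝ)
  | 0 => 0
  | k + 1 => if h : k < N then EuclideanSpace.proj (⟨k, h⟩ : Fin N) else 0

variable {N : ℕ}

@[simp] theorem padded_zero (x : Vec N) : padded x 0 = 1 := rfl

@[simp] theorem padded_succ (x : Vec N) (j : Fin N) : padded x (j + 1) = x j := by
  simp [padded]

theorem padded_eq_zero (x : Vec N) {k : ℕ} (h : N ≤ k) : padded x (k + 1) = 0 := by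
  simp [padded, h]

theorem hasFDerivAt_padded (x : Vec N) (k : ℕ) :
    HasFDerivAt (fun x => padded x k) (paddedDeriv N k) x := by
  cases k with
  | zero => exact hasFDerivAt_const _ _
  | succ k =>
    by_cases h : k < N
    · simp only [padded, paddedDeriv, h, dif_pos]
      exact (EuclideanSpace.proj (⟨k, h⟩ : Fin N) : Vec N →L[ℝ] ℝ).hasFDerivAt
    · simp only [padded, paddedDeriv, h, dif_neg, not_false_eq_true]
      exact hasFDerivAt_const _ _

/-- The chain function with weights `w`. Its `k`-th link couples the coordinates `k - 1` and `k`
(the coordinate `-1` being the constant `1`, the coordinate `N` the constant `0`). -/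
noncomputable def chain (w : ℕ → ℝ) (x : Vec N) : ℝ :=
  ∑ k ∈ Finset.range (N + 1),
    w k * (wall (padded x (k + 1)) - gate (padded x k) * ramp (padded x (k + 1)))

/-- The gradient of `chain w`. -/
noncomputable def chainGrad (w : ℕ → ℝ) (x : Vec N) : Vec N :=
  WithLp.toLp 2 fun j =>
    w j * (wallDeriv (padded x (j + 1)) - gate (padded x j) * rampDeriv (padded x (j + 1)))
      - w (j + 1) * (gateDeriv (padded x (j + 1)) * ramp (padded x (j + 2)))

theorem chainGrad_apply (w : ℕ → ℝ) (x : Vec N) (j : Fin N) :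
    chainGrad w x j =
      w j * (wallDeriv (x j) - gate (padded x j) * rampDeriv (x j))
        - w (j + 1) * (gateDeriv (x j) * ramp (padded x (j + 2))) := by
  simp [chainGrad]

theorem hasGradientAt_chain (w : ℕ → ℝ) (x : Vec N) :
    HasGradientAt (chain w) (chainGrad w x) x := by
  rw [hasGradientAt_iff_hasFDerivAt]
  have hsum := HasFDerivAt.fun_sum (u := Finset.range (N + 1)) fun k _ =>
    (((hasDerivAt_wall (padded x (k + 1))).comp_hasFDerivAt x (hasFDerivAt_padded x (k + 1))).sub
      (((hasDerivAt_gate (padded x k)).comp_hasFDerivAt x (hasFDerivAt_padded x k)).mul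
        ((hasDerivAt_ramp (padded x (k + 1))).comp_hasFDerivAt x
          (hasFDerivAt_padded x (k + 1))))).const_mul (w k)
  refine HasFDerivAt.congr_fderiv (f := chain w) hsum ?_
  ext v
  have e0 : paddedDeriv N 0 v = 0 := rfl
  have eN : paddedDeriv N (N + 1) v = 0 := by simp [paddedDeriv]
  have ej (j : Fin N) : paddedDeriv N (j + 1) v = v j := by simp [paddedDeriv]
  simp only [InnerProductSpace.toDual_apply_apply, PiLp.inner_apply, RCLike.inner_apply, conj_trivial,
    sum_apply, smul_apply, sub_apply,
    add_apply, smul_eq_mul, Function.comp_apply, mul_sub, mul_add,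
    Finset.sum_sub_distrib, Finset.sum_add_distrib]
  rw [Finset.sum_range_succ, Finset.sum_range_succ, Finset.sum_range_succ' _ N, e0, eN]
  simp only [mul_zero, add_zero, Finset.sum_range, ej, ← Finset.sum_sub_distrib,
    ← Finset.sum_add_distrib]
  refine Finset.sum_congr rfl fun j _ => ?_
  simp only [chainGrad]
  ring

theorem sum_padded_sub_sq (x y : Vec N) :
    ∑ j ∈ Finset.range N, |padded x (j + 1) - padded y (j + 1)| ^ 2 = ‖x - y‖ ^ 2 := by
  rw [EuclideanSpace.norm_sq_eq, Finset.sum_range]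
  simp

/-- Weights in `[0, 3]` give a `90`-Lipschitz gradient: each coordinate of the gradient depends on
three consecutive coordinates only, and is Lipschitz in each of them. -/
theorem norm_chainGrad_sub_le {w : ℕ → ℝ} (h₀ : ∀ k, 0 ≤ w k) (h₃ : ∀ k, w k ≤ 3) (x y : Vec N) :
    ‖chainGrad w x - chainGrad w y‖ ≤ 90 * ‖x - y‖ := by
  set D : ℕ → ℝ := fun k => |padded x k - padded y k| with hD
  have D0 : D 0 = 0 := by simp [hD]
  have DN : D (N + 1) = 0 := by simp [hD, padded_eq_zero]
  have hDn k : 0 ≤ D k := abs_nonneg _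
  have key (j : Fin N) : |chainGrad w x j - chainGrad w y j| ≤ 30 * (D j + D (j + 1) + D (j + 2)) := by
    have mulsub {a a' b b' A B α β : ℝ} (ha : |a - a'| ≤ A) (hb : |b - b'| ≤ B) (h1 : |b| ≤ β)
        (h2 : |a'| ≤ α) : |a * b - a' * b'| ≤ A * β + α * B := by
      have : a * b - a' * b' = (a - a') * b + a' * (b - b') := by ring
      rw [this]
      refine (abs_add_le _ _).trans ?_
      rw [abs_mul, abs_mul]
      gcongr
      · exact (abs_nonneg _).trans ha
      · exact (abs_nonneg _).trans h2
    have t1 := abs_wallDeriv_sub_le (padded x (j + 1)) (padded y (j + 1))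
    have t2 := mulsub (abs_gate_sub_le (padded x j) (padded y j))
      (abs_rampDeriv_sub_le (padded x (j + 1)) (padded y (j + 1))) (β := 1) (α := 1)
      (by rw [abs_of_nonneg (rampDeriv_nonneg _)]; exact rampDeriv_le_one _)
      (by rw [abs_of_nonneg (gate_nonneg _)]; exact gate_le_one _)
    have t3 := mulsub (abs_gateDeriv_sub_le (padded x (j + 1)) (padded y (j + 1)))
      (abs_ramp_sub_le (padded x (j + 2)) (padded y (j + 2))) (β := 4) (α := 1)
      (by rw [abs_of_nonneg (ramp_nonneg _)]; exact ramp_le_four _)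
      (by rw [abs_of_nonneg (gateDeriv_nonneg _)]; exact gateDeriv_le_one _)
    have e : chainGrad w x j - chainGrad w y j =
        w j * ((wallDeriv (padded x (j + 1)) - wallDeriv (padded y (j + 1)))
          - (gate (padded x j) * rampDeriv (padded x (j + 1))
            - gate (padded y j) * rampDeriv (padded y (j + 1))))
        - w (j + 1) * (gateDeriv (padded x (j + 1)) * ramp (padded x (j + 2))
          - gateDeriv (padded y (j + 1)) * ramp (padded y (j + 2))) := by
      simp only [chainGrad]
      ring
    rw [e]
    refine (abs_sub _ _).trans ?_
    rw [abs_mul, abs_mul, abs_of_nonneg (h₀ _), abs_of_nonneg (h₀ _)]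
    have s1 := (abs_sub (wallDeriv (padded x (j + 1)) - wallDeriv (padded y (j + 1)))
      (gate (padded x j) * rampDeriv (padded x (j + 1))
            - gate (padded y j) * rampDeriv (padded y (j + 1)))).trans (add_le_add t1 t2)
    have u1 := mul_le_mul (h₃ j) s1 (abs_nonneg _) (by norm_num)
    have u2 := mul_le_mul (h₃ (j + 1)) t3 (abs_nonneg _) (by norm_num)
    refine (add_le_add u1 u2).trans ?_
    have := hDn j
    have := hDn (j + 1)
    have := hDn (j + 2)
    simp only [hD] at *
    linarith
  have hsq : ‖chainGrad w x - chainGrad w y‖ ^ 2 ≤ (90 * ‖x - y‖) ^ 2 := by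
    have s1 : ∑ j ∈ Finset.range N, D (j + 1) ^ 2 = ‖x - y‖ ^ 2 := sum_padded_sub_sq x y
    have s0 : ∑ j ∈ Finset.range N, D j ^ 2 ≤ ‖x - y‖ ^ 2 := by
      have := Finset.sum_range_succ' (fun j => D j ^ 2) N
      rw [Finset.sum_range_succ, s1, D0] at this
      nlinarith [sq_nonneg (D N)]
    have s2 : ∑ j ∈ Finset.range N, D (j + 2) ^ 2 ≤ ‖x - y‖ ^ 2 := by
      have := Finset.sum_range_succ' (fun j => D (j + 1) ^ 2) N
      rw [Finset.sum_range_succ, s1, DN] at this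
      nlinarith [sq_nonneg (D 1)]
    rw [EuclideanSpace.norm_sq_eq]
    calc ∑ j : Fin N, ‖(chainGrad w x - chainGrad w y) j‖ ^ 2
        ≤ ∑ j : Fin N, 2700 * (D j ^ 2 + D (j + 1) ^ 2 + D (j + 2) ^ 2) := by
          refine Finset.sum_le_sum fun j _ => ?_
          have h1 := pow_le_pow_left₀ (abs_nonneg _) (key j) 2
          rw [PiLp.sub_apply, Real.norm_eq_abs]
          nlinarith [sq_nonneg (D j - D (j + 1)), sq_nonneg (D j - D (j + 2)),
            sq_nonneg (D (j + 1) - D (j + 2))]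
      _ = 2700 * (∑ j ∈ Finset.range N, D j ^ 2 + ∑ j ∈ Finset.range N, D (j + 1) ^ 2
            + ∑ j ∈ Finset.range N, D (j + 2) ^ 2) := by
          rw [← Finset.mul_sum, Finset.sum_add_distrib, Finset.sum_add_distrib]
          simp only [Finset.sum_range]
      _ ≤ (90 * ‖x - y‖) ^ 2 := by nlinarith
  exact le_of_sq_le_sq hsq (by positivity)

/-- A coordinate of the gradient at `x` that is not active in `x` comes from one link only, and
that link is open only if the preceding coordinate is active. -/
theorem chainGrad_apply_of_eq_zero (w : ℕ → ℝ) {x : Vec N} {j : Fin N} (h : x j = 0) :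
    chainGrad w x j = -(w j * gate (padded x j)) := by
  rw [chainGrad_apply, h]
  simp [rampDeriv]

theorem neg_le_chain {w : ℕ → ℝ} (h₀ : ∀ k, 0 ≤ w k) (h₁ : ∀ k, w k ≤ 1) (x : Vec N) :
    -(4 * (N + 1 : ℝ)) ≤ chain w x := by
  have : ∑ k ∈ Finset.range (N + 1), (-4 : ℝ) ≤ chain w x := by
    refine Finset.sum_le_sum fun k _ => ?_
    have h1 := wall_nonneg (padded x (k + 1))
    have h2 : gate (padded x k) * ramp (padded x (k + 1)) ≤ 1 * 4 :=
      mul_le_mul (gate_le_one _) (ramp_le_four _) (ramp_nonneg _) zero_le_one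
    have h3 : w k * 4 ≤ 1 * 4 := by nlinarith [h₁ k]
    nlinarith [mul_le_mul_of_nonneg_left h2 (h₀ k), mul_nonneg (h₀ k) h1]
  simp at this
  linarith

theorem chain_zero_nonpos {w : ℕ → ℝ} (h₀ : ∀ k, 0 ≤ w k) : chain w (0 : Vec N) ≤ 0 := by
  refine Finset.sum_nonpos fun k _ => ?_
  have hw : wall (padded (0 : Vec N) (k + 1)) = 0 := by
    by_cases h : k < N <;> simp [padded, h, wall]
  rw [hw, zero_sub]
  nlinarith [mul_nonneg (h₀ k) (mul_nonneg (gate_nonneg (padded (0 : Vec N) k))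
    (ramp_nonneg (padded (0 : Vec N) (k + 1))))]

/-- As long as the last coordinate is inactive the gradient is large: it is at least `1 / 4` in the
first coordinate that is smaller than `1`. -/
theorem quarter_le_norm_chainGrad {x : Vec N} (hx : padded x N < 1) :
    1 / 4 ≤ ‖chainGrad (fun _ => 1) x‖ := by
  classical
  have hex : ∃ k, padded x k < 1 := ⟨N, hx⟩
  obtain ⟨k, hk, hmin⟩ : ∃ k, padded x k < 1 ∧ ∀ m < k, ¬ padded x m < 1 :=
    ⟨Nat.find hex, Nat.find_spec hex, fun m => Nat.find_min hex⟩
  have hkN : k ≤ N := by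
    by_contra! h
    exact hmin N h hx
  obtain ⟨j, rfl⟩ : ∃ j, k = j + 1 := by
    cases k with
    | zero => simp at hk
    | succ j => exact ⟨j, rfl⟩
  have hjN : j < N := hkN
  have hprev : 1 ≤ padded x j := not_lt.1 (hmin j (Nat.lt_succ_self j))
  have hle : chainGrad (fun _ => 1) x ⟨j, hjN⟩ ≤ -(1 / 4) := by
    simp only [chainGrad]
    have p3 := mul_nonneg (gateDeriv_nonneg (padded x (j + 1))) (ramp_nonneg (padded x (j + 2)))
    have p2 := mul_nonneg (gate_nonneg (padded x j)) (rampDeriv_nonneg (padded x (j + 1)))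
    have p1 := wallDeriv_nonpos (padded x (j + 1))
    rcases le_total (-1) (padded x (j + 1)) with h | h
    · have := mul_le_mul (half_le_gate hprev) (half_le_rampDeriv h hk.le) (by norm_num)
        (gate_nonneg _)
      linarith
    · have := wallDeriv_le (padded x (j + 1))
      linarith
  calc (1 / 4 : ℝ) ≤ ‖chainGrad (fun _ => 1) x ⟨j, hjN⟩‖ := by
        rw [Real.norm_eq_abs]
        exact (le_neg.1 hle).trans (neg_le_abs _)
    _ ≤ _ := PiLp.norm_apply_le _ _

/-! ### The rescaled losses -/

/-- The chain function centered at `x₀`, with values scaled by `a` and arguments by `b`. -/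
noncomputable def scaledChain (a b : ℝ) (x₀ : Vec N) (w : ℕ → ℝ) (x : Vec N) : ℝ :=
  a * chain w (b⁻¹ • (x - x₀))

/-- The gradient of `scaledChain a b x₀ w`. -/
noncomputable def scaledGrad (a b : ℝ) (x₀ : Vec N) (w : ℕ → ℝ) (x : Vec N) : Vec N :=
  (a * b⁻¹) • chainGrad w (b⁻¹ • (x - x₀))

theorem hasGradientAt_scaledChain (a b : ℝ) (x₀ : Vec N) (w : ℕ → ℝ) (x : Vec N) :
    HasGradientAt (scaledChain a b x₀ w) (scaledGrad a b x₀ w x) x := by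
  have h1 : HasFDerivAt (fun x : Vec N => b⁻¹ • (x - x₀)) (b⁻¹ • ContinuousLinearMap.id ℝ (Vec N)) x :=
    ((hasFDerivAt_id x).sub_const x₀).const_smul b⁻¹
  have h2 := (hasGradientAt_chain w (b⁻¹ • (x - x₀))).hasFDerivAt
  have h3 := (h2.comp x h1).const_mul a
  rw [hasGradientAt_iff_hasFDerivAt]
  refine HasFDerivAt.congr_fderiv (f := scaledChain a b x₀ w) h3 ?_
  ext v
  simp [scaledGrad]
  ring

theorem gradient_scaledChain (a b : ℝ) (x₀ : Vec N) (w : ℕ → ℝ) :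
    gradient (scaledChain a b x₀ w) = scaledGrad a b x₀ w :=
  gradient_eq (hasGradientAt_scaledChain a b x₀ w)

theorem norm_scaledGrad_sub_le {a b L : ℝ} (ha : 0 < a) (hb : 0 < b) (hab : 90 * a = L * b ^ 2)
    (x₀ : Vec N) {w : ℕ → ℝ} (h₀ : ∀ k, 0 ≤ w k) (h₃ : ∀ k, w k ≤ 3) (x y : Vec N) :
    ‖scaledGrad a b x₀ w x - scaledGrad a b x₀ w y‖ ≤ L * ‖x - y‖ := by
  have h := norm_chainGrad_sub_le h₀ h₃ (b⁻¹ • (x - x₀)) (b⁻¹ • (y - x₀))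
  rw [← smul_sub, sub_sub_sub_cancel_right, norm_smul, Real.norm_of_nonneg (by positivity)] at h
  rw [scaledGrad, scaledGrad, ← smul_sub, norm_smul, Real.norm_of_nonneg (by positivity)]
  calc a * b⁻¹ * _ ≤ a * b⁻¹ * (90 * (b⁻¹ * ‖x - y‖)) := by gcongr
    _ = 90 * a * (b⁻¹ * b⁻¹) * ‖x - y‖ := by ring
    _ = L * ‖x - y‖ := by rw [hab]; field_simp

theorem avgLoss_scaledChain {n : ℕ} (hn : 0 < n) (a b : ℝ) (x₀ : Vec N) {w : Fin n → ℕ → ℝ}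
    (hw : ∀ k, ∑ i, w i k = n) :
    avgLoss (fun i => scaledChain a b x₀ (w i)) = scaledChain a b x₀ (fun _ => 1) := by
  have hn' : (n : ℝ) ≠ 0 := by positivity
  funext x
  simp only [avgLoss, scaledChain, chain]
  rw [← Finset.mul_sum, Finset.sum_comm]
  simp only [← Finset.sum_mul, hw, ← Finset.mul_sum]
  field_simp

theorem lossClass_scaledChain {n : ℕ} (hn : 0 < n) (hN : 0 < N) {a b L Δ : ℝ} (ha : 0 < a)
    (hb : 0 < b) (hab : 90 * a = L * b ^ 2) (haΔ : a * (8 * N) ≤ Δ) (x₀ : Vec N)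
    {w : Fin n → ℕ → ℝ} (h₀ : ∀ i k, 0 ≤ w i k) (h₃ : ∀ i k, w i k ≤ 3)
    (hw : ∀ k, ∑ i, w i k = n) :
    LossClass L Δ x₀ (fun i => scaledChain a b x₀ (w i)) := by
  have hN' : (1 : ℝ) ≤ N := by exact_mod_cast hN
  have hlow x : -Δ ≤ scaledChain a b x₀ (fun _ => 1) x := by
    have := neg_le_chain (w := fun _ => 1) (by simp) (by simp) (b⁻¹ • (x - x₀))
    have := mul_le_mul_of_nonneg_left this ha.le
    unfold scaledChain
    nlinarith
  have hx₀ : scaledChain a b x₀ (fun _ => 1) x₀ ≤ 0 := by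
    have := chain_zero_nonpos (N := N) (w := fun _ => 1) (by simp)
    simp only [scaledChain, sub_self, smul_zero]
    nlinarith
  refine ⟨fun i x => (hasGradientAt_scaledChain a b x₀ (w i) x).differentiableAt, fun i x y => ?_,
    ?_, ?_⟩
  · rw [gradient_scaledChain]
    exact norm_scaledGrad_sub_le ha hb hab x₀ (h₀ i) (h₃ i) x y
  · rw [avgLoss_scaledChain hn a b x₀ hw]
    exact ⟨-Δ, by rintro _ ⟨x, rfl⟩; exact hlow x⟩
  · rw [avgLoss_scaledChain hn a b x₀ hw]
    have := le_ciInf hlow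
    linarith

theorem le_norm_scaledGrad {a b : ℝ} (ha : 0 < a) (hb : 0 < b) {x₀ x : Vec N}
    (hx : padded (x - x₀) N = 0 ) :
    a * b⁻¹ / 4 ≤ ‖scaledGrad a b x₀ (fun _ => 1) x‖ := by
  have hp : padded (b⁻¹ • (x - x₀)) N < 1 := by
    cases N with
    | zero => simp at hx
    | succ m =>
      have : padded (b⁻¹ • (x - x₀)) (m + 1) = 0 := by
        simp only [padded, Nat.lt_succ_self, dif_pos] at hx ⊢
        rw [PiLp.smul_apply, hx, smul_zero]
      rw [this]
      exact one_pos
  have h := quarter_le_norm_chainGrad hp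
  rw [scaledGrad, norm_smul, Real.norm_of_nonneg (by positivity)]
  have := mul_le_mul_of_nonneg_left h (show 0 ≤ a * b⁻¹ by positivity)
  linarith

theorem measurable_scaledGrad {a b L : ℝ} (ha : 0 < a) (hb : 0 < b) (hab : 90 * a = L * b ^ 2)
    (x₀ : Vec N) {w : ℕ → ℝ} (h₀ : ∀ k, 0 ≤ w k) (h₃ : ∀ k, w k ≤ 3) :
    Measurable (scaledGrad a b x₀ w) :=
  (LipschitzWith.of_dist_le_mul (K := L.toNNReal) fun x y => by
    rw [dist_eq_norm, dist_eq_norm]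
    refine (norm_scaledGrad_sub_le ha hb hab x₀ h₀ h₃ x y).trans ?_
    gcongr
    exact Real.le_coe_toNNReal L).continuous.measurable

/-- A coordinate of the gradient is zero unless it is active, or the preceding coordinate is active
(or there is none) and the weight of the link between them is not zero. -/
theorem scaledGrad_apply_eq_zero (a b : ℝ) (x₀ : Vec N) (w : ℕ → ℝ) {x : Vec N} {j : Fin N}
    (hj : x j = x₀ j) (h : w j = 0 ∨ ∃ m : Fin N, (j : ℕ) = m + 1 ∧ x m = x₀ m) :
    scaledGrad a b x₀ w x j = 0 := by
  have h0 : (b⁻¹ • (x - x₀)) j = 0 := by simp [hj]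
  rw [scaledGrad, PiLp.smul_apply, chainGrad_apply_of_eq_zero w h0]
  rcases h with h | ⟨m, hm, hxm⟩
  · simp [h]
  · have : (b⁻¹ • (x - x₀)) m = 0 := by simp [hxm]
    rw [hm, padded_succ, this]
    simp

theorem abs_scaledGrad_apply_le {a b : ℝ} (ha : 0 < a) (hb : 0 < b) (x₀ : Vec N) {w : ℕ → ℝ}
    (h₀ : ∀ k, 0 ≤ w k) (h₃ : ∀ k, w k ≤ 3) {x : Vec N} {j : Fin N} (hj : x j = x₀ j) :
    |scaledGrad a b x₀ w x j| ≤ 3 * (a * b⁻¹) := by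
  have h0 : (b⁻¹ • (x - x₀)) j = 0 := by simp [hj]
  rw [scaledGrad, PiLp.smul_apply, chainGrad_apply_of_eq_zero w h0, smul_eq_mul, abs_mul, abs_neg,
    abs_of_nonneg (mul_nonneg (h₀ j) (gate_nonneg _)), abs_of_pos (by positivity), mul_comm]
  gcongr
  exact (mul_le_mul (h₃ j) (gate_le_one _) (gate_nonneg _) (by norm_num)).trans (by norm_num)

/-! ### The oracle -/

/-- Coordinate `j` is fresh at `x`: neither it nor a later coordinate has left `x₀`. -/
def Fresh (x₀ x : Vec N) (j : Fin N) : Prop := ∀ j', j ≤ j' → x j' = x₀ j'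

/-- The squared length of the fresh part of the gradient: only the first fresh coordinate
contributes. -/
theorem sum_fresh_sq_le {a b : ℝ} (ha : 0 < a) (hb : 0 < b) (x₀ : Vec N) {w : ℕ → ℝ}
    (h₀ : ∀ k, 0 ≤ w k) (h₃ : ∀ k, w k ≤ 3) (x : Vec N) [DecidablePred (Fresh x₀ x)] :
    ∑ j, (if Fresh x₀ x j then scaledGrad a b x₀ w x j ^ 2 else 0) ≤ (3 * (a * b⁻¹)) ^ 2 := by
  by_cases hex : ∃ j, Fresh x₀ x j ∧ scaledGrad a b x₀ w x j ≠ 0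
  · obtain ⟨j, hj, hgj⟩ := hex
    rw [Finset.sum_eq_single j]
    · rw [if_pos hj]
      exact sq_le_sq' (by linarith [abs_le.1 (abs_scaledGrad_apply_le ha hb x₀ h₀ h₃ (hj j le_rfl))])
        (abs_le.1 (abs_scaledGrad_apply_le ha hb x₀ h₀ h₃ (hj j le_rfl))).2
    · intro k _ hkj
      split_ifs with hk
      · suffices scaledGrad a b x₀ w x k = 0 by simp [this]
        rcases lt_or_gt_of_ne hkj with hlt | hgt
        · refine absurd (scaledGrad_apply_eq_zero a b x₀ w (hj j le_rfl) (Or.inr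
            ⟨⟨j - 1, by omega⟩, ?_, hk _ ?_⟩)) hgj
          · have : (k : ℕ) < j := hlt
            simp only
            omega
          · have : (k : ℕ) < j := hlt
            rw [Fin.le_def]
            simp only
            omega
        · refine scaledGrad_apply_eq_zero a b x₀ w (hk k le_rfl) (Or.inr
            ⟨⟨k - 1, by omega⟩, ?_, hj _ ?_⟩)
          · have : (j : ℕ) < k := hgt
            simp only
            omega
          · have : (j : ℕ) < k := hgt
            rw [Fin.le_def]
            simp only
            omega
      · rfl
    · simp
  · push Not at hex
    rw [Finset.sum_eq_zero]
    · positivity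
    · intro j _
      split_ifs with h
      · simp [hex j h]
      · rfl

/-- The Bernoulli law on `Bool`, with mass `p` at `true`. -/
noncomputable def coin (p : ℝ) : Measure Bool :=
  ENNReal.ofReal p • Measure.dirac true + ENNReal.ofReal (1 - p) • Measure.dirac false

theorem isProbabilityMeasure_coin {p : ℝ} (h₀ : 0 ≤ p) (h₁ : p ≤ 1) :
    IsProbabilityMeasure (coin p) := by
  constructor
  simp [coin]
  rw [← ENNReal.ofReal_add h₀ (by linarith)]
  simp

open Classical in
/-- The answer of the noisy oracle with gradient `g`: the fresh coordinates are revealed, multiplied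
by `1 / p`, if the coin shows `true`, and hidden otherwise. -/
noncomputable def noisyAnswer (p : ℝ) (x₀ : Vec N) (g : Vec N → Vec N) (x : Vec N) (ζ : Bool) :
    Vec N :=
  WithLp.toLp 2 fun j => if Fresh x₀ x j then (if ζ then g x j / p else 0) else g x j

theorem measurable_noisyAnswer (p : ℝ) (x₀ : Vec N) {g : Vec N → Vec N} (hg : Measurable g) :
    Measurable (fun q : Vec N × Bool => noisyAnswer p x₀ g q.1 q.2) := by
  unfold noisyAnswer
  refine (WithLp.measurable_toLp 2 _).comp (measurable_pi_lambda _ fun j => ?_)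
  have hgj : Measurable (fun q : Vec N × Bool => g q.1 j) := by fun_prop
  refine Measurable.ite ?_ (Measurable.ite ?_ (hgj.div_const p) measurable_const) hgj
  · have : {q : Vec N × Bool | Fresh x₀ q.1 j} = ⋂ j', ⋂ (_ : j ≤ j'), {q | q.1 j' = x₀ j'} := by
      ext q
      simp [Fresh]
    rw [this]
    refine MeasurableSet.iInter fun j' => MeasurableSet.iInter fun _ => ?_
    exact measurableSet_eq_fun (by fun_prop) measurable_const
  · exact measurable_snd (measurableSet_singleton true)

/-- The oracle that answers by `noisyAnswer`, with independent coins of bias `p`. -/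
noncomputable def noisyOracle {p : ℝ} (h₀ : 0 ≤ p) (h₁ : p ≤ 1) (x₀ : Vec N) {g : Vec N → Vec N}
    (hg : Measurable g) : StochOracle N where
  Seed := Bool
  mSeed := inferInstance
  law := coin p
  isProb := isProbabilityMeasure_coin h₀ h₁
  answer := noisyAnswer p x₀ g
  measurable_answer := measurable_noisyAnswer p x₀ hg

theorem noisyAnswer_apply_eq_zero (p : ℝ) (x₀ : Vec N) {g : Vec N → Vec N} {x : Vec N} {j : Fin N}
    (h : g x j = 0) (ζ : Bool) : noisyAnswer p x₀ g x ζ j = 0 := by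
  simp [noisyAnswer, h]

theorem noisyAnswer_false_apply_eq_zero (p : ℝ) (x₀ : Vec N) (g : Vec N → Vec N) {x : Vec N}
    {j : Fin N} (h : Fresh x₀ x j) : noisyAnswer p x₀ g x false j = 0 := by
  simp [noisyAnswer, h]

open Classical in
/-- The variance of the noisy oracle is `(1 - p) / p` times the squared length of the fresh part of the
gradient. -/
theorem oracleClass_noisyOracle {p σ G : ℝ} (h₀ : 0 < p) (h₁ : p ≤ 1) (x₀ : Vec N)
    {g : Vec N → Vec N} (hg : Measurable g) {f : Vec N → ℝ} (hf : gradient f = g)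
    (hG : ∀ x, ∑ j, (if Fresh x₀ x j then g x j ^ 2 else 0) ≤ G)
    (hσ : G * (1 - p) ≤ p * σ ^ 2) :
    OracleClass σ f (noisyOracle h₀.le h₁ x₀ hg) := by
  have hint (x : Vec N) : Integrable (noisyAnswer p x₀ g x) (coin p) := by
    have := isProbabilityMeasure_coin h₀.le h₁
    exact Integrable.of_finite
  refine ⟨hint, fun x => ?_, fun x => ?_⟩
  · change ∫ ζ, noisyAnswer p x₀ g x ζ ∂(coin p) = gradient f x
    rw [hf, coin, integral_add_measure, integral_smul_measure, integral_smul_measure,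
      integral_dirac, integral_dirac, ENNReal.toReal_ofReal h₀.le,
      ENNReal.toReal_ofReal (by linarith)]
    · ext j
      by_cases hj : Fresh x₀ x j
      · simp [noisyAnswer, hj]
        field_simp
      · simp [noisyAnswer, hj]
        ring
    · exact (hint x).mono_measure (Measure.le_add_right le_rfl)
    · exact (hint x).mono_measure (Measure.le_add_left le_rfl)
  · change ∫⁻ ζ, ‖noisyAnswer p x₀ g x ζ - gradient f x‖ₑ ^ 2 ∂(coin p) ≤ _
    have hsq (v : Vec N) : ‖v‖ₑ ^ 2 = ENNReal.ofReal (‖v‖ ^ 2) := by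
      rw [ENNReal.ofReal_pow (norm_nonneg _), ofReal_norm]
    set S := ∑ j, (if Fresh x₀ x j then g x j ^ 2 else 0) with hS
    have htrue : ‖noisyAnswer p x₀ g x true - g x‖ ^ 2 = (1 / p - 1) ^ 2 * S := by
      rw [EuclideanSpace.norm_sq_eq, hS, Finset.mul_sum]
      refine Finset.sum_congr rfl fun j _ => ?_
      by_cases hj : Fresh x₀ x j
      · simp [noisyAnswer, hj]
        ring
      · simp [noisyAnswer, hj]
    have hfalse : ‖noisyAnswer p x₀ g x false - g x‖ ^ 2 = S := by
      rw [EuclideanSpace.norm_sq_eq, hS]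
      refine Finset.sum_congr rfl fun j _ => ?_
      by_cases hj : Fresh x₀ x j <;> simp [noisyAnswer, hj]
    have hS0 : 0 ≤ S := Finset.sum_nonneg fun j _ => by split_ifs <;> positivity
    rw [hf, coin, lintegral_add_measure, lintegral_smul_measure, lintegral_smul_measure,
      lintegral_dirac, lintegral_dirac, hsq, hsq, htrue, hfalse, smul_eq_mul, smul_eq_mul,
      ← ENNReal.ofReal_mul h₀.le, ← ENNReal.ofReal_mul (by linarith),
      ← ENNReal.ofReal_add (by positivity) (mul_nonneg (by linarith) hS0)]
    refine ENNReal.ofReal_le_ofReal ?_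
    have e : p * ((1 / p - 1) ^ 2 * S) + (1 - p) * S = S * (1 - p) / p := by
      field_simp
      ring
    rw [e, div_le_iff₀ h₀]
    calc S * (1 - p) ≤ G * (1 - p) := mul_le_mul_of_nonneg_right (hG x) (by linarith)
      _ ≤ σ ^ 2 * p := by linarith

/-! ### Propagation of active coordinates -/

/-- If `K t i` bounds the coordinates active at node `i` before round `t`, and `G t i` those active
after its query, then the oracles and the communication network control the growth of the bounds. -/
theorem lt_of_active_run {n d : ℕ} {A : DecAlgorithm n d} (hA : A.ZeroRespecting)
    {W : ℕ → Matrix (Fin n) (Fin n) ℝ} {x₀ : Vec d} {O : Fin n → StochOracle d} {r : A.Rand}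
    {ζ : (a : ℕ × Fin n) → (O a.2).Seed} {K G : ℕ → Fin n → ℕ}
    (hKG : ∀ t i, K t i ≤ G t i)
    (horacle : ∀ t i (u : Vec d), (∀ k : Fin d, K t i ≤ k → u k = 0) →
      ∀ k : Fin d, G t i ≤ k → (O i).answer (x₀ + u) (ζ (t, i)) k = 0)
    (hself : ∀ t i, G t i ≤ K (t + 1) i)
    (hcomm : ∀ t i j, W t i j ≠ 0 → G t j ≤ K (t + 1) i) (t : ℕ) (i : Fin n) (k : Fin d)
    (hk : (A.run W x₀ O r ζ t i).Active k) : (k : ℕ) < K t i := by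
  induction t generalizing i k with
  | zero => exact hk.choose.elim0
  | succ t ih =>
    have hanswer (j : Fin n) (k : Fin d) (h : G t j ≤ k) :
        A.oracleAnswer x₀ O r ζ t (A.run W x₀ O r ζ t) j k = 0 := by
      refine horacle t j _ (fun k' hk' => ?_) k h
      by_contra hne
      exact absurd (ih j k' (hA.query t j r _ k' hne)) (not_lt.2 hk')
    have hmessage (j : Fin n) (l : Fin A.m) (k : Fin d) (h : G t j ≤ k) :
        A.message t j r (A.run W x₀ O r ζ t j)
          (A.oracleAnswer x₀ O r ζ t (A.run W x₀ O r ζ t) j) l k = 0 := by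
      by_contra hne
      rcases hA.message t j r _ _ l k hne with h' | h'
      · exact absurd (ih j k h') (not_lt.2 ((hKG t j).trans h))
      · exact h' (hanswer j k h)
    by_contra! hlt
    obtain ⟨s, hs⟩ := hk
    rw [DecAlgorithm.run] at hs
    revert hs
    refine Fin.lastCases ?_ (fun s => ?_) s
    · simp only [Fin.snoc_last]
      rintro (h | ⟨l, h⟩)
      · exact h (hanswer i k ((hself t i).trans hlt))
      · refine h ?_
        rw [WithLp.ofLp_sum, Finset.sum_apply]
        refine Finset.sum_eq_zero fun j _ => ?_
        rw [PiLp.smul_apply]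
        by_cases hW : W t i j = 0
        · simp [hW]
        · rw [hmessage j l k ((hcomm t i j hW).trans hlt), smul_zero]
    · simp only [Fin.snoc_castSucc]
      intro h
      exact absurd (ih i k ⟨s, h⟩) (not_lt.2 (((hKG t i).trans (hself t i)).trans hlt))

/-- If the last coordinate is not reached on the event `E`, the gradient is large there. -/
theorem le_expectedSqGrad {n N : ℕ} {A : DecAlgorithm n N} {W : ℕ → Matrix (Fin n) (Fin n) ℝ}
    {x₀ : Vec N} {O : Fin n → StochOracle N} {f : Fin n → Vec N → ℝ} {T : ℕ} {a b : ℝ}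
    (ha : 0 < a) (hb : 0 < b) (hf : avgLoss f = scaledChain a b x₀ (fun _ => 1))
    {E : Set (A.Rand × ((a : ℕ × Fin n) → (O a.2).Seed))} (hE : MeasurableSet E)
    (h : ∀ ω ∈ E, padded (A.output T ω.1 (A.run W x₀ O ω.1 ω.2 T)) N = 0) :
    ENNReal.ofReal ((a * b⁻¹ / 4) ^ 2) * A.randomness O E ≤ A.expectedSqGrad W x₀ O f T := by
  rw [DecAlgorithm.expectedSqGrad, ← setLIntegral_const]
  refine (setLIntegral_mono' hE fun ω hω => ?_).trans (setLIntegral_le_lintegral E _)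
  rw [hf, gradient_scaledChain, ENNReal.ofReal_pow (by positivity)]
  gcongr
  rw [← ofReal_norm]
  refine ENNReal.ofReal_le_ofReal (le_norm_scaledGrad ha hb ?_)
  rw [DecAlgorithm.finalPoint, add_sub_cancel_left]
  exact h ω hω

/-! ### Weights on sun-shaped graphs -/

open Classical in
/-- The weight matrix `1 - Λ / n` of the sun-shaped graph with center set `C`, where `Λ` is the graph
Laplacian: every edge gets the weight `1 / n`. It is `J / n` corrected on the nodes outside `C`. -/
noncomputable def sunWeight {n : ℕ} (C : Set (Fin n)) : Matrix (Fin n) (Fin n) ℝ :=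
  Matrix.of fun i j => 1 / (n : ℝ) +
    if i ∈ C ∨ j ∈ C then 0
    else (if i = j then ((Finset.univ.filter (· ∉ C)).card : ℝ) / n else 0) - 1 / n

variable {n : ℕ} {C : Set (Fin n)}

theorem sunWeight_eq_zero {i j : Fin n} (hij : i ≠ j) (hi : i ∉ C) (hj : j ∉ C) :
    sunWeight C i j = 0 := by
  simp [sunWeight, hij, hi, hj]

theorem sunWeight_of_mem {i j : Fin n} (h : i ∈ C ∨ j ∈ C) : sunWeight C i j = 1 / n := by
  simp [sunWeight, h]

theorem sunWeight_symm (i j : Fin n) : sunWeight C i j = sunWeight C j i := by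
  by_cases hi : i ∈ C <;> by_cases hj : j ∈ C <;> simp [sunWeight, hi, hj, eq_comm]

open Classical in
theorem sum_sunWeight (hn : 0 < n) (i : Fin n) : ∑ j, sunWeight C i j = 1 := by
  have hn' : (n : ℝ) ≠ 0 := by positivity
  simp only [sunWeight, Matrix.of_apply]
  rw [Finset.sum_add_distrib]
  by_cases hi : i ∈ C
  · simp [hi, hn']
  · have e (j : Fin n) : (if i ∈ C ∨ j ∈ C then (0 : ℝ)
        else (if i = j then ((Finset.univ.filter (· ∉ C)).card : ℝ) / n else 0) - 1 / n) =
        (if i = j then ((Finset.univ.filter (· ∉ C)).card : ℝ) / n else 0) -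
          (if j ∉ C then 1 / (n : ℝ) else 0) := by
      by_cases hj : j ∈ C
      · have : i ≠ j := fun h => hi (h ▸ hj)
        simp [hj, this]
      · simp [hi, hj]
    simp only [e, Finset.sum_sub_distrib]
    rw [Finset.sum_ite_eq, if_pos (Finset.mem_univ _), ← Finset.sum_filter, Finset.sum_const,
      Finset.sum_const, Finset.card_univ, Fintype.card_fin, nsmul_eq_mul, nsmul_eq_mul]
    field_simp
    ring

open Classical in
/-- On vectors supported outside `C`, the matrix `W - J / n` is `α - J / n` with `α` the proportion of
nodes outside `C`; on the centers it vanishes. -/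
theorem norm_sunWeight_le {β : ℝ} (hn : 0 < n) (hβ : 0 ≤ β)
    (hC : ((Finset.univ.filter (· ∉ C)).card : ℝ) ≤ n * β) :
    ‖Matrix.toEuclideanCLM (n := Fin n) (𝕜 := ℝ)
      (sunWeight C - Matrix.of (fun _ _ => 1 / (n : ℝ)))‖ ≤ β := by
  have hn' : (0 : ℝ) < n := by positivity
  refine ContinuousLinearMap.opNorm_le_bound _ hβ fun x => ?_
  refine le_of_sq_le_sq ?_ (by positivity)
  set D := Finset.univ.filter (· ∉ C) with hD
  set α : ℝ := (D.card : ℝ) / n with hα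
  set S := ∑ j ∈ D, x j with hS
  have hα0 : 0 ≤ α := by positivity
  have hαβ : α ≤ β := by rw [hα, div_le_iff₀ hn']; linarith
  have hcoord (i : Fin n) : (Matrix.toEuclideanCLM (n := Fin n) (𝕜 := ℝ)
      (sunWeight C - Matrix.of (fun _ _ => 1 / (n : ℝ))) x) i =
      if i ∈ D then α * x i - S / n else 0 := by
    rw [Matrix.ofLp_toEuclideanCLM, Matrix.mulVec, dotProduct]
    by_cases hi : i ∈ C
    · simp [sunWeight, hi, hD]
    · have hiD : i ∈ D := by simp [hD, hi]
      rw [if_pos hiD]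
      have e (j : Fin n) : (sunWeight C - Matrix.of (fun _ _ => 1 / (n : ℝ)) : Matrix (Fin n) (Fin n) ℝ) i j * x j =
          (if i = j then α * x j else 0) - (if j ∈ D then x j / n else 0) := by
        by_cases hj : j ∈ C
        · have : i ≠ j := fun h => hi (h ▸ hj)
          simp [sunWeight, hj, hD, this]
        · have hjD : j ∈ D := by simp [hD, hj]
          simp only [Matrix.sub_apply, sunWeight, Matrix.of_apply, hi, hj, or_self, if_false, hjD,
            if_true]
          split_ifs <;> ring
      simp only [e, Finset.sum_sub_distrib]
      rw [Finset.sum_ite_eq, if_pos (Finset.mem_univ _), ← Finset.sum_filter, hS, Finset.sum_div]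
      simp
  rw [EuclideanSpace.norm_sq_eq, mul_pow, EuclideanSpace.norm_sq_eq]
  simp only [hcoord, Real.norm_eq_abs, sq_abs]
  have hQ : ∑ j ∈ D, x j ^ 2 ≤ ∑ j, x j ^ 2 :=
    Finset.sum_le_sum_of_subset_of_nonneg (Finset.subset_univ _) fun _ _ _ => sq_nonneg _
  have hQ0 : 0 ≤ ∑ j ∈ D, x j ^ 2 := Finset.sum_nonneg fun _ _ => sq_nonneg _
  calc ∑ i, (if i ∈ D then α * x i - S / n else 0) ^ 2
      = ∑ i ∈ D, (α * x i - S / n) ^ 2 := by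
        simp only [ite_pow, ne_eq, OfNat.ofNat_ne_zero, not_false_eq_true, zero_pow]
        rw [← Finset.sum_filter]
        simp
    _ = α ^ 2 * ∑ i ∈ D, x i ^ 2 - 2 * α * (S / n) * S + D.card * (S / n) ^ 2 := by
        have e (i : Fin n) : (α * x i - S / n) ^ 2 =
            α ^ 2 * x i ^ 2 - 2 * α * (S / n) * x i + (S / n) ^ 2 := by ring
        simp only [e, Finset.sum_add_distrib, Finset.sum_sub_distrib, ← Finset.mul_sum,
          Finset.sum_const, nsmul_eq_mul, ← hS]
    _ = α ^ 2 * ∑ i ∈ D, x i ^ 2 - α * (S ^ 2 / n) := by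
        have : (D.card : ℝ) = α * n := by rw [hα]; field_simp
        rw [this]
        field_simp
        ring
    _ ≤ α ^ 2 * ∑ i ∈ D, x i ^ 2 := by
        have : 0 ≤ α * (S ^ 2 / n) := by positivity
        linarith
    _ ≤ β ^ 2 * ∑ i, x i ^ 2 := by gcongr

open Classical in
theorem weightClass_sunWeight {β : ℝ} (hn : 0 < n) (hβ : 0 ≤ β)
    (hC : ((Finset.univ.filter (· ∉ C)).card : ℝ) ≤ n * β) :
    WeightClass β (sunGraph C) (sunWeight C) where
  zero_of_not_adj i j hij h := by
    simp only [sunGraph, not_and, not_or] at h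
    exact sunWeight_eq_zero hij (h hij.symm).2 (h hij.symm).1
  row_sum i := sum_sunWeight hn i
  col_sum j := by simp only [sunWeight_symm _ j, sum_sunWeight hn j]
  norm_le := norm_sunWeight_le hn hβ hC

/-! ### Counting successful coins -/

/-- Markov's inequality for the number of coins in `s` that show `true`. -/
theorem infinitePi_coin_mul_le {ι : Type*} {p : ℝ} [IsProbabilityMeasure (coin p)] (s : Finset ι)
    (N : ℕ) :
    (N : ENNReal) * Measure.infinitePi (fun _ : ι => coin p) {ζ | N ≤ ∑ a ∈ s, (ζ a).toNat} ≤
      s.card * ENNReal.ofReal p := by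
  have hm (a : ι) : Measurable (fun ζ : ι → Bool => ((ζ a).toNat : ENNReal)) :=
    (measurable_of_finite (fun b : Bool => (b.toNat : ENNReal))).comp (measurable_pi_apply a)
  have h1 (a : ι) : ∫⁻ ζ, ((ζ a).toNat : ENNReal) ∂Measure.infinitePi (fun _ : ι => coin p) =
      ENNReal.ofReal p := by
    rw [(measurePreserving_eval_infinitePi (fun _ : ι => coin p) a).lintegral_comp
      (measurable_of_finite (fun b : Bool => (b.toNat : ENNReal)))]
    simp [coin]
  have h2 : ∫⁻ ζ, ∑ a ∈ s, ((ζ a).toNat : ENNReal) ∂Measure.infinitePi (fun _ : ι => coin p) =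
      s.card * ENNReal.ofReal p := by
    rw [lintegral_finsetSum _ fun a _ => hm a]
    simp [h1]
  rw [← h2]
  refine le_trans (le_of_eq ?_) (mul_meas_ge_le_lintegral (Finset.measurable_fun_sum s fun a _ => hm a) N)
  congr 2
  ext ζ
  rw [Set.mem_ofPred_eq, Set.mem_ofPred_eq]
  rw [← Nat.cast_sum, Nat.cast_le]

theorem randomness_preimage_snd {n d : ℕ} (A : DecAlgorithm n d) (O : Fin n → StochOracle d)
    (E : Set ((a : ℕ × Fin n) → (O a.2).Seed)) :
    A.randomness O (Prod.snd ⁻¹' E) = Measure.infinitePi (fun a : ℕ × Fin n => (O a.2).law) E := by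
  rw [DecAlgorithm.randomness, ← Set.univ_prod, Measure.prod_prod, measure_univ, one_mul]

theorem padded_last_eq_zero {N : ℕ} (hN : 0 < N) {u : Vec N}
    (h : ∀ k : Fin N, (k : ℕ) + 1 = N → u k = 0) : padded u N = 0 := by
  obtain ⟨m, rfl⟩ : ∃ m, N = m + 1 := ⟨N - 1, by omega⟩
  simp only [padded, Nat.lt_succ_self, dif_pos]
  exact h _ rfl

/-- Scaling the chain of length `N` to smoothness `L` and initial gap `Δ`; the gradient is scaled by
`a * b⁻¹`. -/
theorem exists_scale {N : ℕ} (hN : 0 < N) {L Δ : ℝ} (hL : 0 < L) (hΔ : 0 < Δ) :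
    ∃ a b : ℝ, 0 < a ∧ 0 < b ∧ 90 * a = L * b ^ 2 ∧ a * (8 * N) ≤ Δ ∧
      (a * b⁻¹) ^ 2 = Δ * L / (720 * N) := by
  have hN' : (0 : ℝ) < N := by positivity
  have ha : 0 < Δ / (8 * N) := by positivity
  have hb : 0 < Real.sqrt (90 * (Δ / (8 * N)) / L) := by positivity
  have hb2 : Real.sqrt (90 * (Δ / (8 * N)) / L) ^ 2 = 90 * (Δ / (8 * N)) / L :=
    Real.sq_sqrt (by positivity)
  refine ⟨_, _, ha, hb, ?_, ?_, ?_⟩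
  · rw [hb2]
    field_simp
  · field_simp
    rfl
  · rw [mul_pow, inv_pow, hb2]
    field_simp
    norm_num

/-! ### The noise term -/

/-- The lower bound due to the noise of the oracles: all the nodes share one chain, and a new
coordinate is revealed only when some coin shows `true`. -/
theorem noise_lower_bound {n T : ℕ} (hn : 0 < n) (W : ℕ → Matrix (Fin n) (Fin n) ℝ) {L Δ σ : ℝ}
    (hL : 0 < L) (hΔ : 0 < Δ) (hσ : 0 < σ) (hT0 : 0 < T) (hT : σ ^ 2 / (n * L * Δ) ≤ T) :
    ∃ d : ℕ, 0 < d ∧ ∀ x₀ : Vec d, ∃ (f : Fin n → Vec d → ℝ) (O : Fin n → StochOracle d),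
      LossClass L Δ x₀ f ∧ (∀ i, OracleClass σ (f i) (O i)) ∧
      ∀ A : DecAlgorithm n d, A.ZeroRespecting →
        ENNReal.ofReal (Real.sqrt (Δ * L * σ ^ 2 / (n * T)) / 46080)
          ≤ A.expectedSqGrad W x₀ O f T := by
  classical
  have hn' : (0 : ℝ) < n := by positivity
  have hT' : (0 : ℝ) < T := by positivity
  set X : ℝ := n * T * Δ * L / σ ^ 2 with hX
  have hX1 : 1 ≤ X := by
    rw [div_le_iff₀ (by positivity)] at hT
    rw [hX, le_div_iff₀ (by positivity)]
    linarith
  have hsX : 1 ≤ Real.sqrt X := Real.one_le_sqrt.2 hX1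
  have hsq : Real.sqrt X ^ 2 = X := Real.sq_sqrt (by linarith)
  set N := ⌈Real.sqrt X⌉₊ with hNdef
  have hN1 : Real.sqrt X ≤ N := Nat.le_ceil _
  have hN2 : (N : ℝ) ≤ 2 * Real.sqrt X := by
    have := (Nat.ceil_lt_add_one (Real.sqrt_nonneg X)).le
    linarith
  have hN : 0 < N := by
    have : (0 : ℝ) < N := by linarith
    exact_mod_cast this
  have hN' : (0 : ℝ) < N := by positivity
  obtain ⟨a, b, ha, hb, hab, haΔ, hab2⟩ := exists_scale hN hL hΔ
  set G : ℝ := (3 * (a * b⁻¹)) ^ 2 with hG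
  have hGval : G = Δ * L / (80 * N) := by
    rw [hG, mul_pow, hab2]
    field_simp
    norm_num
  have hG0 : 0 < G := by positivity
  set p : ℝ := min 1 (G / σ ^ 2) with hp
  have hp0 : 0 < p := lt_min one_pos (by positivity)
  have hp1 : p ≤ 1 := min_le_left _ _
  have hpG : G * (1 - p) ≤ p * σ ^ 2 := by
    rcases min_choice 1 (G / σ ^ 2) with h | h
    · rw [hp, h]
      nlinarith [sq_nonneg σ]
    · have : p * σ ^ 2 = G := by rw [hp, h]; field_simp
      nlinarith
  refine ⟨N, hN, fun x₀ => ?_⟩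
  have hg := measurable_scaledGrad (w := fun _ => 1) ha hb hab x₀ (by simp) (by norm_num)
  have := isProbabilityMeasure_coin hp0.le hp1
  refine ⟨fun _ => scaledChain a b x₀ (fun _ => 1), fun _ => noisyOracle hp0.le hp1 x₀ hg,
    lossClass_scaledChain hn hN ha hb hab haΔ x₀ (w := fun _ _ => 1) (by simp) (by norm_num)
      (by simp), fun _ => oracleClass_noisyOracle hp0 hp1 x₀ hg
        (gradient_scaledChain a b x₀ (fun _ => 1))
        (fun x => sum_fresh_sq_le ha hb x₀ (by simp) (by norm_num) x) hpG, fun A hA => ?_⟩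
  -- Each revealing answer activates at most one new coordinate, so that `cnt` bounds the progress.
  let cnt : ℕ → (ℕ × Fin n → Bool) → ℕ := fun t ζ =>
    ∑ c ∈ Finset.range t ×ˢ (Finset.univ : Finset (Fin n)), (ζ c).toNat
  have hgrow (t : ℕ) (i : Fin n) (ζ : ℕ × Fin n → Bool) :
      cnt t ζ + (ζ (t, i)).toNat ≤ cnt (t + 1) ζ := by
    simp only [cnt, Finset.sum_product]
    rw [Finset.sum_range_succ]
    exact Nat.add_le_add_left (Finset.single_le_sum (f := fun i => (ζ (t, i)).toNat)
      (fun _ _ => Nat.zero_le _) (Finset.mem_univ i)) _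
  let E : Set (ℕ × Fin n → Bool) := {ζ | N ≤ cnt T ζ}
  have hEm : MeasurableSet E := by
    refine measurableSet_le measurable_const ?_
    exact Finset.measurable_fun_sum _ fun c _ =>
      (measurable_of_finite Bool.toNat).comp (measurable_pi_apply c)
  -- By Markov's inequality, fewer than `N` coins show `true` with probability at least `1 / 2`.
  have hE : Measure.infinitePi (fun _ : ℕ × Fin n => coin p) E ≤ 2⁻¹ := by
    have h := infinitePi_coin_mul_le (p := p) (Finset.range T ×ˢ (Finset.univ : Finset (Fin n))) N
    have hle : ((Finset.range T ×ˢ (Finset.univ : Finset (Fin n))).card : ENNReal) *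
        ENNReal.ofReal p ≤ N * 2⁻¹ := by
      rw [← ENNReal.ofReal_natCast, ← ENNReal.ofReal_natCast, ← ENNReal.ofReal_ofNat,
        ← ENNReal.ofReal_inv_of_pos two_pos, ← ENNReal.ofReal_mul (by positivity),
        ← ENNReal.ofReal_mul (by positivity)]
      refine ENNReal.ofReal_le_ofReal ?_
      have hp2 : p ≤ G / σ ^ 2 := min_le_right _ _
      rw [Finset.card_product, Finset.card_range, Finset.card_univ, Fintype.card_fin, Nat.cast_mul]
      calc (T : ℝ) * n * p ≤ T * n * (G / σ ^ 2) := by gcongr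
        _ = X / (80 * N) := by rw [hGval, hX]; field_simp
        _ ≤ N * 2⁻¹ := by
          rw [div_le_iff₀ (by positivity), ← hsq]
          nlinarith
    have hNtop : (N : ENNReal) ≠ ⊤ := ENNReal.natCast_ne_top N
    have hN0 : (N : ENNReal) ≠ 0 := by exact_mod_cast hN.ne'
    exact (ENNReal.mul_le_mul_iff_right hN0 hNtop).1 (h.trans hle)
  have hEc : (2 : ENNReal)⁻¹ ≤ Measure.infinitePi (fun _ : ℕ × Fin n => coin p) Eᶜ := by
    rw [prob_compl_eq_one_sub hEm]
    refine le_trans ?_ (tsub_le_tsub_left hE 1)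
    rw [ENNReal.one_sub_inv_two]
  have key := le_expectedSqGrad (A := A) (W := W) (T := T) (x₀ := x₀)
    (O := fun _ : Fin n => noisyOracle hp0.le hp1 x₀ hg)
    (f := fun _ : Fin n => scaledChain a b x₀ (fun _ => 1)) (E := Prod.snd ⁻¹' Eᶜ) ha hb
    (avgLoss_scaledChain hn a b x₀ (w := fun _ _ => 1) (by simp)) (measurable_snd hEm.compl) ?_
  · refine le_trans ?_ key
    rw [randomness_preimage_snd]
    refine le_trans ?_ (mul_le_mul_right hEc _)
    rw [← ENNReal.ofReal_ofNat, ← ENNReal.ofReal_inv_of_pos two_pos,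
      ← ENNReal.ofReal_mul (by positivity)]
    refine ENNReal.ofReal_le_ofReal ?_
    have h1 : Real.sqrt (Δ * L * σ ^ 2 / (n * T)) = Δ * L / Real.sqrt X := by
      rw [Real.sqrt_eq_iff_mul_self_eq (by positivity) (by positivity), ← sq, div_pow, hsq, hX]
      field_simp
    rw [h1, div_pow, hab2]
    calc Δ * L / Real.sqrt X / 46080 = Δ * L / (720 * (2 * Real.sqrt X)) / 4 ^ 2 * 2⁻¹ := by
          field_simp
          norm_num
      _ ≤ Δ * L / (720 * N) / 4 ^ 2 * 2⁻¹ := by gcongr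
  · intro ω hω
    have hω' : cnt T ω.2 < N := not_le.1 hω
    refine padded_last_eq_zero hN fun k hk => ?_
    by_contra hne
    obtain ⟨i, hi⟩ := hA.output T ω.1 _ k hne
    have hlt := lt_of_active_run hA (K := fun t _ => cnt t ω.2)
      (G := fun t i => cnt t ω.2 + (ω.2 (t, i) : Bool).toNat) (fun _ _ => Nat.le_add_right _ _) ?_
      ?_ ?_ T i k hi
    · omega
    · intro t i u hu k hk
      change noisyAnswer p x₀ _ (x₀ + u) (ω.2 (t, i) : Bool) k = 0
      change cnt t ω.2 + (ω.2 (t, i) : Bool).toNat ≤ k at hk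
      have hu' (k : Fin N) (h : cnt t ω.2 ≤ k) : (x₀ + u) k = x₀ k := by
        rw [PiLp.add_apply, hu k h, add_zero]
      generalize hc : (ω.2 (t, i) : Bool) = c at hk ⊢
      cases c with
      | false =>
        exact noisyAnswer_false_apply_eq_zero p x₀ _ fun k' hk' =>
          hu' k' ((le_trans (Nat.le_add_right _ _) hk).trans hk')
      | true =>
        simp only [Bool.toNat_true] at hk
        refine noisyAnswer_apply_eq_zero p x₀ (scaledGrad_apply_eq_zero a b x₀ _
          (hu' k (by omega)) (Or.inr ⟨⟨k - 1, by omega⟩, ?_, hu' _ ?_⟩)) true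
        · simp only
          omega
        · simp only
          omega
    · exact fun t i => hgrow t i ω.2
    · exact fun t i j _ => hgrow t j ω.2

/-! ### The communication term -/

theorem card_block {n q b : ℕ} (hq : 0 < q) (h : (b + 1) * q ≤ n) :
    (Finset.univ.filter fun i : Fin n => (i : ℕ) / q = b).card = q := by
  have e : (Finset.univ.filter fun i : Fin n => (i : ℕ) / q = b).card =
      ((Finset.range n).filter fun i => i / q = b).card := by
    rw [Finset.card_filter, Finset.card_filter, Finset.sum_range]
  have e2 : ((Finset.range n).filter fun i => i / q = b) = Finset.Ico (b * q) ((b + 1) * q) := by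
    ext i
    have : (b + 1) * q = b * q + q := by ring
    simp only [Finset.mem_filter, Finset.mem_range, Finset.mem_Ico, Nat.div_eq_iff hq]
    omega
  rw [e, e2, Nat.card_Ico, add_mul, one_mul, Nat.add_sub_cancel_left]

/-- The center set of round `t`: the last nodes are divided into blocks of `k` nodes, counted from
the end, of which the first `τ` take turns. -/
def center (n k τ t : ℕ) : Set (Fin n) := {i | (i.rev : ℕ) / k = t % τ}

theorem mem_center {n k τ t : ℕ} {i : Fin n} : i ∈ center n k τ t ↔ (i.rev : ℕ) / k = t % τ :=
  Iff.rfl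

open Classical in
theorem card_compl_center {n k τ : ℕ} (hk : 0 < k) (hτ : 0 < τ) (h : τ * k ≤ n) (t : ℕ) :
    (Finset.univ.filter (· ∉ center n k τ t)).card = n - k := by
  have h1 : (t % τ + 1) * k ≤ n := (Nat.mul_le_mul_right k (Nat.mod_lt t hτ)).trans h
  have h2 := card_block hk h1
  have h3 : (Finset.univ.filter (· ∈ center n k τ t)).card = k := by
    refine Eq.trans ?_ h2
    refine Finset.card_bij' (fun i _ => i.rev) (fun i _ => i.rev) ?_ ?_ ?_ ?_ <;>
      simp [mem_center, -Fin.val_rev]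
  have h4 := Finset.card_filter_add_card_filter_not (s := (Finset.univ : Finset (Fin n)))
    (· ∈ center n k τ t)
  rw [h3, Finset.card_univ, Fintype.card_fin] at h4
  omega

/-- The share of node `i` in link `k` of the chain: the even links are shared by the first `q` nodes,
the odd links by the next `q` nodes. -/
noncomputable def splitWeight (n q i k : ℕ) : ℝ := if i / q = k % 2 then (n : ℝ) / q else 0

theorem splitWeight_nonneg (n q i k : ℕ) : 0 ≤ splitWeight n q i k := by
  unfold splitWeight
  positivity

theorem splitWeight_le_three {n q : ℕ} (hq : 0 < q) (h : n ≤ 3 * q) (i k : ℕ) :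
    splitWeight n q i k ≤ 3 := by
  unfold splitWeight
  split_ifs
  · rw [div_le_iff₀ (by positivity)]
    exact_mod_cast h
  · norm_num

theorem sum_splitWeight {n q : ℕ} (hq : 0 < q) (h : 2 * q ≤ n) (k : ℕ) :
    ∑ i : Fin n, splitWeight n q i k = n := by
  unfold splitWeight
  have hk : (k % 2 + 1) * q ≤ n := (Nat.mul_le_mul_right q (Nat.mod_lt k two_pos)).trans h
  rw [← Finset.sum_filter, Finset.sum_const, card_block hq hk, nsmul_eq_mul]
  field_simp

/-- The lower bound due to the communication. Consecutive links of the chain are held by disjoint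
groups of nodes, and `τ` rounds are needed to carry news from one group to the other, so that at most
one coordinate is gained in `τ` rounds. -/
theorem network_lower_bound {n q k τ : ℕ} (hq : 0 < q) (hq2 : 2 * q ≤ n) (hq3 : n ≤ 3 * q)
    (hk : 0 < k) (hτ : 0 < τ) (hτq : 1 < τ → τ * k + 2 * q ≤ n) {L Δ : ℝ} (σ : ℝ) (hL : 0 < L) (hΔ : 0 < Δ)
    (T : ℕ) :
    ∃ d : ℕ, 0 < d ∧ ∀ x₀ : Vec d, ∃ (f : Fin n → Vec d → ℝ) (O : Fin n → StochOracle d),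
      LossClass L Δ x₀ f ∧ (∀ i, OracleClass σ (f i) (O i)) ∧
      ∀ A : DecAlgorithm n d, A.ZeroRespecting →
        ENNReal.ofReal (Δ * L / (11520 * (T / τ + 2 : ℕ)))
          ≤ A.expectedSqGrad (fun t => sunWeight (center n k τ t)) x₀ O f T := by
  classical
  have hn : 0 < n := by omega
  set N := T / τ + 2 with hNdef
  have hN : 0 < N := Nat.succ_pos _
  obtain ⟨a, b, ha, hb, hab, haΔ, hab2⟩ := exists_scale hN hL hΔ
  refine ⟨N, hN, fun x₀ => ?_⟩
  let w : Fin n → ℕ → ℝ := fun i => splitWeight n q i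
  have hw0 (i : Fin n) (k : ℕ) : 0 ≤ w i k := splitWeight_nonneg n q i k
  have hw3 (i : Fin n) (k : ℕ) : w i k ≤ 3 := splitWeight_le_three hq hq3 i k
  have hws (k : ℕ) : ∑ i, w i k = n := sum_splitWeight hq hq2 k
  have hg (i : Fin n) := measurable_scaledGrad ha hb hab x₀ (hw0 i) (hw3 i)
  refine ⟨fun i => scaledChain a b x₀ (w i), fun i => noisyOracle zero_le_one le_rfl x₀ (hg i),
    lossClass_scaledChain hn hN ha hb hab haΔ x₀ hw0 hw3 hws, fun i =>
      oracleClass_noisyOracle one_pos le_rfl x₀ (hg i) (gradient_scaledChain a b x₀ (w i))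
        (fun x => sum_fresh_sq_le ha hb x₀ (hw0 i) (hw3 i) x)
        (by rw [sub_self, mul_zero]; positivity), fun A hA => ?_⟩
  -- In period `s = t / τ` the first `s` coordinates are known to everybody, and coordinate `s` to
  -- the group holding link `s` and to the centers of the past rounds of the period.
  let K : ℕ → Fin n → ℕ := fun t i =>
    t / τ + if (i : ℕ) / q = t / τ % 2 ∨ (i.rev : ℕ) / k < t % τ then 1 else 0
  have hKle (t : ℕ) (i : Fin n) : K t i ≤ t / τ + 1 := by
    simp only [K]
    split_ifs <;> omega
  have hstep (t : ℕ) : (t % τ + 1 < τ ∧ (t + 1) / τ = t / τ ∧ (t + 1) % τ = t % τ + 1) ∨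
      ((t + 1) / τ = t / τ + 1) := by
    have h1 := Nat.mod_lt t hτ
    have h2 := Nat.mod_add_div t τ
    rcases Nat.lt_or_ge (t % τ + 1) τ with h | h
    · refine Or.inl ⟨h, ?_⟩
      have e : t + 1 = (t % τ + 1) + τ * (t / τ) := by omega
      constructor
      · rw [e, Nat.add_mul_div_left _ _ hτ, Nat.div_eq_of_lt h, zero_add]
      · rw [e, Nat.add_mul_mod_self_left, Nat.mod_eq_of_lt h]
    · refine Or.inr ?_
      have e : t + 1 = τ * (t / τ + 1) := by rw [mul_add]; omega
      rw [e, Nat.mul_div_cancel_left _ hτ]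
  have hblock {r : ℕ} {i : Fin n} (h1 : 1 < τ) (hr : r < τ) (hi : (i.rev : ℕ) / k ≤ r) :
      2 ≤ (i : ℕ) / q := by
    have hτ' := hτq h1
    have h2 : (i.rev : ℕ) < τ * k := (Nat.div_lt_iff_lt_mul hk).1 (hi.trans_lt hr)
    rw [Fin.val_rev] at h2
    rw [Nat.le_div_iff_mul_le hq]
    omega
  have hself (t : ℕ) (i : Fin n) : K t i ≤ K (t + 1) i := by
    rcases hstep t with ⟨_, h2, h3⟩ | h
    · simp only [K, h2, h3]
      split_ifs <;> omega
    · exact (hKle t i).trans (by simp only [K, h]; omega)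
  have key := le_expectedSqGrad (A := A) (W := fun t => sunWeight (center n k τ t)) (T := T)
    (x₀ := x₀) (O := fun i => noisyOracle zero_le_one le_rfl x₀ (hg i))
    (f := fun i => scaledChain a b x₀ (w i)) (E := Prod.snd ⁻¹' Set.univ) ha hb
    (avgLoss_scaledChain hn a b x₀ hws) (measurable_snd MeasurableSet.univ) ?_
  · refine le_trans (le_of_eq ?_) key
    rw [randomness_preimage_snd, measure_univ, mul_one, div_pow, hab2]
    congr 1
    field_simp
    norm_num
  · intro ω _
    refine padded_last_eq_zero hN fun m hm => ?_
    by_contra hne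
    obtain ⟨i, hi⟩ := hA.output T ω.1 _ m hne
    have hlt := lt_of_active_run hA (K := K) (G := K) (fun _ _ => le_rfl) ?_ hself ?_ T i m hi
    · have := hKle T i
      omega
    · intro t i u hu m hm
      change noisyAnswer 1 x₀ _ (x₀ + u) (ω.2 (t, i) : Bool) m = 0
      have hu' (m : Fin N) (h : K t i ≤ m) : (x₀ + u) m = x₀ m := by
        rw [PiLp.add_apply, hu m h, add_zero]
      refine noisyAnswer_apply_eq_zero 1 x₀ (scaledGrad_apply_eq_zero a b x₀ _ (hu' m hm) ?_) _
      rcases hm.eq_or_lt with h | h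
      · refine Or.inl ?_
        simp only [w, splitWeight]
        refine if_neg fun hi => ?_
        rw [← h] at hi
        simp only [K] at hi
        split_ifs at hi with hc
        · rcases hc with hc | hc
          · omega
          · have h1 := Nat.mod_lt t hτ
            have h2 : 0 < t % τ := Nat.zero_lt_of_lt hc
            have := hblock (by omega) h1 hc.le
            omega
        · exact hc (Or.inl hi)
      · refine Or.inr ⟨⟨m - 1, by omega⟩, ?_, hu' _ ?_⟩
        · simp only
          omega
        · simp only
          omega
    · intro t i j hW
      rcases hstep t with ⟨h1, h2, h3⟩ | h
      · by_cases hij : i = j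
        · exact hij ▸ hself t i
        by_cases hi : i ∈ center n k τ t
        · refine (hKle t j).trans ?_
          have hi' : (i.rev : ℕ) / k = t % τ := mem_center.1 hi
          simp only [K, h2, h3]
          rw [if_pos (Or.inr (by omega))]
        by_cases hj : j ∈ center n k τ t
        · have hj' : (j.rev : ℕ) / k = t % τ := mem_center.1 hj
          have := hblock (by omega) (Nat.mod_lt t hτ) hj'.le
          have hK : K t j = t / τ := by
            simp only [K]
            rw [if_neg (by omega), add_zero]
          rw [hK]
          simp only [K, h2]
          exact Nat.le_add_right _ _
        · exact absurd (sunWeight_eq_zero hij hi hj) hW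
      · refine (hKle t j).trans ?_
        simp only [K, h]
        omega

end SunChain

open SunChain

theorem theorem2 :
    ∃ c : ℝ, 0 < c ∧
      ∀ (n : ℕ) (L Δ σ β : ℝ), 2 ≤ n → 0 < L → 0 < Δ → 0 < σ → 0 ≤ β → β ≤ 1 - 1 / (n : ℝ) →
        ∃ (C : ℕ → Set (Fin n)) (W : ℕ → Matrix (Fin n) (Fin n) ℝ),
          (∀ t, WeightClass β (sunGraph (C t)) (W t)) ∧
          (∀ t i j, (sunGraph (C t)).Adj i j → W t i j ≠ 0) ∧
          ∀ T : ℕ, 1 / (1 - β) ≤ (T : ℝ) → σ ^ 2 / (n * L * Δ) ≤ (T : ℝ) →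
            ∃ d : ℕ, 0 < d ∧ ∀ x₀ : Vec d,
              ∃ (f : Fin n → Vec d → ℝ) (O : Fin n → StochOracle d),
                LossClass L Δ x₀ f ∧
                (∀ i, OracleClass σ (f i) (O i)) ∧
                ∀ A : DecAlgorithm n d, A.ZeroRespecting →
                  ENNReal.ofReal
                      (c * (Real.sqrt (Δ * L * σ ^ 2 / (n * T)) + Δ * L / (T * (1 - β))))
                    ≤ A.expectedSqGrad W x₀ O f T := by
  classical
  refine ⟨1 / 600000, by norm_num, fun n L Δ σ β hn hL hΔ hσ hβ hβn => ?_⟩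
  have hn0 : 0 < n := by omega
  have hn' : (0 : ℝ) < n := by positivity
  have hnβ : 1 ≤ n * (1 - β) := by
    have := mul_le_mul_of_nonneg_left hβn hn'.le
    rw [mul_sub, mul_one_div_cancel hn'.ne'] at this
    linarith
  have h1β : 0 < 1 - β := by
    by_contra! h
    nlinarith
  -- `k` centers in each round, two groups of `q` nodes, and `τ` blocks of centers between them.
  set k := ⌈n * (1 - β)⌉₊ with hk
  have hk1 : n * (1 - β) ≤ k := Nat.le_ceil _
  have hk2 : (k : ℝ) ≤ 2 * (n * (1 - β)) := by
    have := (Nat.ceil_lt_add_one (show 0 ≤ n * (1 - β) by linarith)).le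
    linarith
  have hk0 : 0 < k := by
    have : (0 : ℝ) < k := by linarith
    exact_mod_cast this
  have hkn : k ≤ n := Nat.ceil_le.2 (by nlinarith)
  set q := (n + 2) / 3 with hq
  have hq0 : 0 < q := by omega
  have hq2 : 2 * q ≤ n := by omega
  have hq3 : n ≤ 3 * q := by omega
  set τ := max 1 ((n - 2 * q) / k) with hτdef
  have hτ1 : 1 ≤ τ := le_max_left _ _
  have hτM : (n - 2 * q) / k ≤ τ := le_max_right _ _
  have hτq : 1 < τ → τ * k + 2 * q ≤ n := by
    intro h
    have e : τ = (n - 2 * q) / k := by omega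
    have := Nat.div_mul_le_self (n - 2 * q) k
    rw [e]
    omega
  have hτn : τ * k ≤ n := by
    rcases Nat.lt_or_ge 1 τ with h | h
    · have := hτq h
      omega
    · have : τ = 1 := by omega
      rw [this]
      omega
  -- For `n < 8` this holds since `n * (1 - β) ≥ 1`; otherwise `n / 6` nodes lie between the groups.
  have hτβ : 1 ≤ 24 * (1 - β) * τ := by
    have hτ1' : (1 : ℝ) ≤ τ := by exact_mod_cast hτ1
    rcases Nat.lt_or_ge n 8 with h | h
    · have h' : (n : ℝ) ≤ 8 := by exact_mod_cast h.le
      nlinarith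
    · have h1 : n - 2 * q < 2 * (τ * k) := by
        have h2 := Nat.lt_div_mul_add (a := n - 2 * q) hk0
        have h3 := Nat.mul_le_mul_right k hτM
        have h4 := Nat.mul_le_mul_right k hτ1
        omega
      have h5 : n ≤ 12 * (τ * k) := by omega
      have h6 : (n : ℝ) ≤ 12 * (τ * k) := by exact_mod_cast h5
      have h7 : (n : ℝ) * 1 ≤ n * (24 * (1 - β) * τ) := by nlinarith
      exact le_of_mul_le_mul_left h7 hn'
  refine ⟨center n k τ, fun t => sunWeight (center n k τ t), fun t => ?_, fun t i j hij => ?_,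
    fun T hTβ hTσ => ?_⟩
  · refine weightClass_sunWeight hn0 hβ ?_
    rw [card_compl_center hk0 hτ1 hτn t, Nat.cast_sub hkn]
    linarith
  · change sunWeight _ i j ≠ 0
    rw [sunWeight_of_mem hij.2]
    positivity
  have hT1 : 1 ≤ T * (1 - β) := by rwa [div_le_iff₀ h1β] at hTβ
  have hT' : (0 : ℝ) < T := by
    by_contra! h
    nlinarith
  have hT0 : 0 < T := by exact_mod_cast hT'
  set S := Real.sqrt (Δ * L * σ ^ 2 / (n * T)) with hS
  set R := Δ * L / (T * (1 - β)) with hR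
  have hS0 : 0 ≤ S := Real.sqrt_nonneg _
  have hR0 : 0 ≤ R := by positivity
  -- The larger of the two terms decides which instance is used.
  rcases le_total R S with h | h
  · obtain ⟨d, hd, H⟩ := noise_lower_bound hn0 (fun t => sunWeight (center n k τ t)) hL hΔ hσ hT0 hTσ
    refine ⟨d, hd, fun x₀ => ?_⟩
    obtain ⟨f, O, hf, hO, hA⟩ := H x₀
    refine ⟨f, O, hf, hO, fun A hZ => le_trans (ENNReal.ofReal_le_ofReal ?_) (hA A hZ)⟩
    linarith
  · obtain ⟨d, hd, H⟩ := network_lower_bound (k := k) hq0 hq2 hq3 hk0 hτ1 hτq σ hL hΔ T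
    refine ⟨d, hd, fun x₀ => ?_⟩
    obtain ⟨f, O, hf, hO, hA⟩ := H x₀
    refine ⟨f, O, hf, hO, fun A hZ => le_trans (ENNReal.ofReal_le_ofReal ?_) (hA A hZ)⟩
    have hN : ((T / τ + 2 : ℕ) : ℝ) ≤ 26 * (T * (1 - β)) := by
      have h1 : ((T / τ : ℕ) : ℝ) ≤ T / τ := Nat.cast_div_le
      have hτ' : (0 : ℝ) < τ := by exact_mod_cast hτ1
      have h2 : (T : ℝ) / τ ≤ 24 * (T * (1 - β)) := by
        rw [div_le_iff₀ hτ']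
        nlinarith
      push_cast
      linarith
    calc 1 / 600000 * (S + R) ≤ R / 299520 := by linarith
      _ = Δ * L / (11520 * (26 * (T * (1 - β)))) := by
        rw [hR]
        field_simp
        norm_num
      _ ≤ _ := by gcongr
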